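/- Let $p$ be a prime, $k$ an algebraic closure of $\mathbf{F}_p$, $n\ge 1$. Let $J$ be the $n\times n$ antidiagonal matrix with entries $1$, $\Psi=\begin{pmatrix}0&-J\\J&0\end{pmatrix}$, and $G=Sp(2n)=\{g\in GL_{2n}: {}^tg\Psi g=\Psi\}$ over $k$. Let $B\subset G$ be the subgroup of lower triangular matrices, $T$ the diagonal torus, with $X^*(T)=\mathbf{Z}^n$ via $(a_1,\dots,a_n)\mapsto\big(\mathrm{diag}(x_1,\dots,x_n,x_n^{-1},\dots,x_1^{-1})\mapsto x_1^{a_1}\cdots x_n^{a_n}\big)$, and standard basis $e_1,\dots,e_n$; characters of $T$ are extended to $B$ by means of $B\to T$. Let $P$ (resp. $Q$) be the subgroup of those $g\in G$ whose upper right (resp. lower left) $n\times n$ block is zero, $L=P\cap Q\cong GL_n$ (upper left block), $B_L=B\cap L$ (the lower triangular matrices of $GL_n$), $\varphi$ the $p$-power Frobenius on matrix entries, $\overline{x}\in L$ the Levi component (block diagonal part) of an element $x$ of $P$ or of $Q$, and $$E=\{(x,y)\in P\times Q:\ \varphi(\overline{x})=\overline{y}\},$$ which acts on $G$ by $(x,y)\cdot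 g=xgy^{-1}$. For $\lambda\in X^*(T)$ let $V(\lambda)=\mathrm{Ind}_{B_L}^L\lambda$ be the space of regular functions $f:L\to k$ with $f(xb)=\lambda(b)^{-1}f(x)$ for $x\in L$, $b\in B_L$, with the $L$-action $(l\cdot f)(x)=f(l^{-1}x)$, and let $\mathcal{V}(\lambda)$ be the attached vector bundle on the stack $G\text{-}\mathrm{Zip}=[E\backslash G]$, so that $H^0(G\text{-}\mathrm{Zip},\mathcal{V}(\lambda))$ is the space of regular maps $F:G\to V(\lambda)$ with $F(xgy^{-1})=\overline{x}\cdot F(g)$ for all $(x,y)\in E$, $g\in G$. Put $$C_{\rm zip}=\{\lambda\in X^*(T):\ H^0(G\text{-}\mathrm{Zip},\mathcal{V}(\lambda))\ne 0\},\qquad X^*_{+,I}(T)=\{(a_1,\dots,a_n)\in\mathbf{Z}^n:\ a_1\ge a_2\ge\dots\ge a_n\}.$$ For a subset $C\subset\mathbf{Z}^n$ that is an additive submonoid, $\langle C\rangle=\{x\in\mathbf{Z}^n:\ \exists m\ge1,\ mx\in C\}$ is its saturation; a saturated cone is an additive submonoid equal to its saturation, and the cone s-generated by a set of vectors is the smallest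 saturated cone containing it. Let $C_{\rm pol}$ be the cone s-generated by the vectors $e_i-pe_j$, $1\le i,j\le n$, and for $\Sigma\subset\{1,\dots,n\}^2$ let $C_\Sigma$ be the cone s-generated by the $e_i-pe_j$ with $(i,j)\in\Sigma$. Call $\Sigma$ large if there is a nonempty Zariski open subset $U\subset M_n(k)$ such that for every $x\in U$ there is a lower triangular $b\in GL_n(k)$ for which the $(i,j)$ entry of $b\,x\,\varphi(b)^{-1}$ is zero for all $(i,j)\notin\Sigma$. Finally let $$\Sigma_1=\{(i,j): i\ge j\}\cup\{(i,n+1-i):1\le i\le n\},\qquad \Sigma_1'=\{(i,j): i> j\}\cup\{(i,n+1-i):1\le i\le n\}.$$ Then: 1. $\langle C_{\rm zip}\rangle\subset C_{\rm pol}\cap X^*_{+,I}(T)$. 2. For every large subset $\Sigma\subset\{1,\dots,n\}^2$, $\langle C_{\rm zip}\rangle\subset C_\Sigma$. 3. The subset $\Sigma_1$ is large. 4. $\langle C_{\rm zip}\rangle\subset C_{\Sigma_1'}\cap X^*_{+,I}(T)$. -/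

import Mathlib

namespace SympZip

open Matrix

noncomputable section

/-! ### Cones in a commutative group `M` -/

/-- The saturation `⟨C⟩ = {x ∈ M | ∃ m ≥ 1, m x ∈ C}`. -/
def saturation {M : Type*} [AddCommGroup M] (C : Set M) : Set M :=
  {x | ∃ m : ℕ, 1 ≤ m ∧ m • x ∈ C}

/-- The cone s-generated by a set `S`: the smallest saturated cone (a cone is an additive
submonoid) of `M` containing `S`. -/
def sGenerated {M : Type*} [AddCommGroup M] (S : Set M) : AddSubmonoid M :=
  sInf {C : AddSubmonoid M | S ⊆ (C : Set M) ∧ saturation (C : Set M) = (C : Set M)}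

/-! ### Matrix groups -/

/-- The invertible matrices that are block triangular for the index function `b`: the entry
`(i, j)` vanishes whenever `b j < b i`. -/
def triangularSubgroup {m α : Type*} [Fintype m] [DecidableEq m] [LinearOrder α]
    (k : Type*) [Field k] (b : m → α) : Subgroup (GL m k) where
  carrier := {g | BlockTriangular (g : Matrix m m k) b}
  one_mem' := blockTriangular_one
  mul_mem' := fun {g h} hg hh => by
    simpa using BlockTriangular.mul hg hh
  inv_mem' := fun {g} hg => by
    have hg' : BlockTriangular (g : Matrix m m k) b := hg
    have : BlockTriangular ((g : Matrix m m k)⁻¹) b := by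
      let _ := g.invertible
      exact blockTriangular_inv_of_blockTriangular hg'
    simpa using this

/-- The lower triangular Borel subgroup of `GL_n`: the entry `(i, j)` vanishes for `i < j`.
Under the isomorphism `GL_n ≃ L`, sending `A` to the block matrix `diag(A, J (Aᵗ)⁻¹ J)`, it
corresponds to `B_L`. -/
abbrev lowerBorel (n : ℕ) (k : Type*) [Field k] : Subgroup (GL (Fin n) k) :=
  triangularSubgroup k (fun i : Fin n => OrderDual.toDual i)

section Group

variable (n : ℕ) (k : Type*) [Field k]

/-- The index set `{1, …, 2n}`, as two consecutive blocks of length `n`. -/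
abbrev Idx (n : ℕ) : Type := Fin n ⊕ Fin n

/-- The antidiagonal matrix `J`. -/
def antiJ : Matrix (Fin n) (Fin n) k := Matrix.of fun i j => if j = i.rev then 1 else 0

/-- The symplectic form `Ψ`. -/
def formPsi : Matrix (Idx n) (Idx n) k := fromBlocks 0 (-antiJ n k) (antiJ n k) 0

/-- `G(k)` for `G = Sp(2n)`, the group of matrices `g` with `gᵗ Ψ g = Ψ`. -/
def symplectic : Subgroup (GL (Idx n) k) where
  carrier := {g | (g : Matrix (Idx n) (Idx n) k)ᵀ * formPsi n k *
    (g : Matrix (Idx n) (Idx n) k) = formPsi n k}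
  one_mem' := by simp
  mul_mem' := fun {g h} hg hh => by
    simp only [Set.mem_ofPred_eq, Units.val_mul, transpose_mul] at hg hh ⊢
    calc (h : Matrix (Idx n) (Idx n) k)ᵀ * (g : Matrix (Idx n) (Idx n) k)ᵀ * formPsi n k *
          ((g : Matrix (Idx n) (Idx n) k) * (h : Matrix (Idx n) (Idx n) k))
        = (h : Matrix (Idx n) (Idx n) k)ᵀ * ((g : Matrix (Idx n) (Idx n) k)ᵀ * formPsi n k *
          (g : Matrix (Idx n) (Idx n) k)) * (h : Matrix (Idx n) (Idx n) k) := by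
          simp only [Matrix.mul_assoc]
      _ = formPsi n k := by rw [hg, hh]
  inv_mem' := fun {g} hg => by
    simp only [Set.mem_ofPred_eq] at hg ⊢
    have h1 : (g : Matrix (Idx n) (Idx n) k) * ((g⁻¹ : GL (Idx n) k) : Matrix _ _ k) = 1 := by
      rw [← Units.val_mul, mul_inv_cancel, Units.val_one]
    have h2 : ((g⁻¹ : GL (Idx n) k) : Matrix (Idx n) (Idx n) k)ᵀ *
        (g : Matrix (Idx n) (Idx n) k)ᵀ = 1 := by
      rw [← transpose_mul, h1, transpose_one]
    calc ((g⁻¹ : GL (Idx n) k) : Matrix (Idx n) (Idx n) k)ᵀ * formPsi n k *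
          ((g⁻¹ : GL (Idx n) k) : Matrix (Idx n) (Idx n) k)
        = ((g⁻¹ : GL (Idx n) k) : Matrix (Idx n) (Idx n) k)ᵀ *
            ((g : Matrix (Idx n) (Idx n) k)ᵀ * formPsi n k * (g : Matrix (Idx n) (Idx n) k)) *
            ((g⁻¹ : GL (Idx n) k) : Matrix (Idx n) (Idx n) k) := by rw [hg]
      _ = (((g⁻¹ : GL (Idx n) k) : Matrix (Idx n) (Idx n) k)ᵀ *
            (g : Matrix (Idx n) (Idx n) k)ᵀ) * formPsi n k *
            ((g : Matrix (Idx n) (Idx n) k) *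
              ((g⁻¹ : GL (Idx n) k) : Matrix (Idx n) (Idx n) k)) := by
          simp only [Matrix.mul_assoc]
      _ = formPsi n k := by rw [h1, h2, Matrix.one_mul, Matrix.mul_one]

/-- `G(k)` as a type. -/
abbrev G : Type _ := ↥(symplectic n k)

variable {n k} in
/-- The matrix of an element of `G(k)`. -/
def mat (g : G n k) : Matrix (Idx n) (Idx n) k := ((g : GL (Idx n) k) : Matrix _ _ k)

/-- The parabolic `P`, the stabilizer of `Span(u_{n+1}, …, u_{2n})`: the upper right block
vanishes. -/
def parP : Subgroup (G n k) :=
  (triangularSubgroup k (Sum.elim (fun _ => (1 : ℕ)) (fun _ => 0) : Idx n → ℕ)).comap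
    (symplectic n k).subtype

/-- The opposite parabolic `Q`, the stabilizer of `Span(u_1, …, u_n)`: the lower left block
vanishes. -/
def parQ : Subgroup (G n k) :=
  (triangularSubgroup k (Sum.elim (fun _ => (0 : ℕ)) (fun _ => 1) : Idx n → ℕ)).comap
    (symplectic n k).subtype

/-- The common Levi subgroup `L = P ∩ Q`. -/
def levi : Subgroup (G n k) := parP n k ⊓ parQ n k

/-- The Borel subgroup `B` of lower triangular matrices in `G`. -/
def borel : Subgroup (G n k) :=
  (triangularSubgroup k (fun i : Idx n => OrderDual.toDual
    (Sum.elim (fun a : Fin n => (a : ℕ)) (fun a : Fin n => n + (a : ℕ)) i))).comap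
    (symplectic n k).subtype

variable {n k}

/-- The block diagonal part of a matrix. -/
def blockDiag (M : Matrix (Idx n) (Idx n) k) : Matrix (Idx n) (Idx n) k :=
  fromBlocks M.toBlocks₁₁ 0 0 M.toBlocks₂₂

theorem mat_mul (g h : G n k) : mat (g * h) = mat g * mat h := rfl

theorem mat_one : mat (1 : G n k) = 1 := rfl

theorem mat_form (g : G n k) : (mat g)ᵀ * formPsi n k * mat g = formPsi n k := g.2

theorem mem_parP {g : G n k} : g ∈ parP n k ↔ (mat g).toBlocks₁₂ = 0 := by
  constructor
  · intro h
    ext i j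
    exact h (i := Sum.inl i) (j := Sum.inr j) (by simp)
  · intro h i j hij
    rcases i with i | i <;> rcases j with j | j <;> simp at hij
    exact congrFun (congrFun h i) j

theorem mem_parQ {g : G n k} : g ∈ parQ n k ↔ (mat g).toBlocks₂₁ = 0 := by
  constructor
  · intro h
    ext i j
    exact h (i := Sum.inr i) (j := Sum.inl j) (by simp)
  · intro h i j hij
    rcases i with i | i <;> rcases j with j | j <;> simp at hij
    exact congrFun (congrFun h i) j

theorem blockDiag_one : blockDiag (1 : Matrix (Idx n) (Idx n) k) = 1 := by
  rw [blockDiag, ← fromBlocks_one]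
  simp only [toBlocks_fromBlocks₁₁, toBlocks_fromBlocks₂₂]

theorem blockDiag_mul_of_lower {M N : Matrix (Idx n) (Idx n) k}
    (hM : M.toBlocks₁₂ = 0) (hN : N.toBlocks₁₂ = 0) :
    blockDiag (M * N) = blockDiag M * blockDiag N := by
  rw [← fromBlocks_toBlocks M, ← fromBlocks_toBlocks N, hM, hN]
  simp [blockDiag, fromBlocks_multiply]

theorem blockDiag_mul_of_upper {M N : Matrix (Idx n) (Idx n) k}
    (hM : M.toBlocks₂₁ = 0) (hN : N.toBlocks₂₁ = 0) :
    blockDiag (M * N) = blockDiag M * blockDiag N := by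
  rw [← fromBlocks_toBlocks M, ← fromBlocks_toBlocks N, hM, hN]
  simp [blockDiag, fromBlocks_multiply]

theorem blockDiag_form {M : Matrix (Idx n) (Idx n) k}
    (hM : M.toBlocks₁₂ = 0 ∨ M.toBlocks₂₁ = 0) (h : Mᵀ * formPsi n k * M = formPsi n k) :
    (blockDiag M)ᵀ * formPsi n k * blockDiag M = formPsi n k := by
  obtain ⟨A, B, C, D, rfl⟩ : ∃ A B C D, M = fromBlocks A B C D :=
    ⟨_, _, _, _, (fromBlocks_toBlocks M).symm⟩
  rcases hM with hM | hM <;>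
  · simp only [toBlocks_fromBlocks₁₂, toBlocks_fromBlocks₂₁] at hM
    subst hM
    simp only [blockDiag, formPsi, fromBlocks_transpose, fromBlocks_multiply, fromBlocks_inj,
      toBlocks_fromBlocks₁₁, toBlocks_fromBlocks₂₂, transpose_zero, Matrix.zero_mul,
      Matrix.mul_zero, zero_add, add_zero] at h ⊢
    exact ⟨trivial, h.2.1, h.2.2.1, trivial⟩

/-- Auxiliary construction of the Levi projection of a subgroup `H` of `G` on which taking block
diagonal parts is multiplicative. -/
def leviProjAux (H : Subgroup (G n k))
    (hH : ∀ g ∈ H, (mat g).toBlocks₁₂ = 0 ∨ (mat g).toBlocks₂₁ = 0)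
    (hmul : ∀ g ∈ H, ∀ h ∈ H, blockDiag (mat g * mat h) = blockDiag (mat g) * blockDiag (mat h)) :
    ↥H →* ↥(levi n k) :=
  (((MonoidHom.toHomUnits
    { toFun := fun g : H => blockDiag (mat (g : G n k))
      map_one' := by
        show blockDiag (mat (1 : G n k)) = 1
        rw [mat_one, blockDiag_one]
      map_mul' := fun g h => hmul g g.2 h h.2 }).codRestrict (symplectic n k)
        fun g => blockDiag_form (hH g g.2) (mat_form _))).codRestrict (levi n k) fun g =>
          ⟨mem_parP.2 (toBlocks_fromBlocks₁₂ _ _ _ _), mem_parQ.2 (toBlocks_fromBlocks₂₁ _ _ _ _)⟩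

variable (n k)

/-- The Levi component `P → L`, `x ↦ x̄`: the block diagonal part. -/
def leviP : ↥(parP n k) →* ↥(levi n k) :=
  leviProjAux (parP n k) (fun _ hg => Or.inl (mem_parP.1 hg))
    fun _ hg _ hh => blockDiag_mul_of_lower (mem_parP.1 hg) (mem_parP.1 hh)

/-- The Levi component `Q → L`, `y ↦ ȳ`: the block diagonal part. -/
def leviQ : ↥(parQ n k) →* ↥(levi n k) :=
  leviProjAux (parQ n k) (fun _ hg => Or.inr (mem_parQ.1 hg))
    fun _ hg _ hh => blockDiag_mul_of_upper (mem_parQ.1 hg) (mem_parQ.1 hh)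

/-- The inclusion of the Levi subgroup in the general linear group. -/
def leviToGL : ↥(levi n k) →* GL (Idx n) k :=
  (symplectic n k).subtype.comp (levi n k).subtype

/-- The `p`-power Frobenius of a general linear group. -/
def frobGL (p : ℕ) {m : Type*} [Fintype m] [DecidableEq m] (k : Type*) [Field k] [ExpChar k p] :
    GL m k →* GL m k :=
  GeneralLinearGroup.map (frobenius k p)

/-- The zip group `E = {(x, y) ∈ P × Q | φ(x̄) = ȳ}`. -/
def zipGroup (p : ℕ) [ExpChar k p] : Subgroup (↥(parP n k) × ↥(parQ n k)) :=
  MonoidHom.eqLocus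
    (((frobGL p k).comp (leviToGL n k)).comp ((leviP n k).comp (MonoidHom.fst _ _)))
    ((leviToGL n k).comp ((leviQ n k).comp (MonoidHom.snd _ _)))

end Group

/-! ### Regular functions and automorphic bundles -/

section Sections

variable {n : ℕ} {k : Type*} [Field k]

/-- The algebra of regular functions on a closed subvariety `X` of a space of matrices, given by
its inclusion `c`: the functions that are polynomials in the matrix entries. -/
def regularFunctions {X m : Type*} (c : X → Matrix m m k) : Subalgebra k (X → k) :=
  Algebra.adjoin k (Set.range fun (ij : m × m) (x : X) => c x ij.1 ij.2)

theorem regularFunctions_comp_mul_left {X m : Type*} [Fintype m] (c : X → Matrix m m k)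
    (τ : X → X) (A : Matrix m m k) (hτ : ∀ x, c (τ x) = A * c x) {f : X → k}
    (hf : f ∈ regularFunctions c) : (fun x => f (τ x)) ∈ regularFunctions c := by
  unfold regularFunctions at hf
  induction hf using Algebra.adjoin_induction with
  | mem f hf =>
    obtain ⟨⟨i, j⟩, rfl⟩ := hf
    have : (fun x => c (τ x) i j) = ∑ l, A i l • fun x => c x l j := by
      funext x
      simp [hτ, Matrix.mul_apply]
    show (fun x => c (τ x) i j) ∈ _
    rw [this]
    have hgen : ∀ l, (fun x => c x l j) ∈ regularFunctions c := fun l =>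
      Algebra.subset_adjoin (Set.mem_range_self (f := fun (ij : m × m) (x : X) => c x ij.1 ij.2)
        (l, j))
    exact Subalgebra.sum_mem _ fun l _ => Subalgebra.smul_mem _ (hgen l) _
  | algebraMap r => exact Subalgebra.algebraMap_mem _ r
  | add f g _ _ hf hg => exact Subalgebra.add_mem _ hf hg
  | mul f g _ _ hf hg => exact Subalgebra.mul_mem _ hf hg

/-- The value at `b ∈ B` of the character `λ = (a_1, …, a_n)` of the torus
`T = {diag(x_1, …, x_n, x_n⁻¹, …, x_1⁻¹)}`, `X^*(T) = ℤⁿ`, extended to `B`; it is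
`x_1 ^ a_1 ⋯ x_n ^ a_n` where `x_1, …, x_n` are the first `n` diagonal entries of `b`. -/
def charVal (a : Fin n → ℤ) (b : G n k) : k :=
  ∏ i, mat b (Sum.inl i) (Sum.inl i) ^ a i

/-- The underlying matrix of an element of `L`. -/
def leviMat (x : ↥(levi n k)) : Matrix (Idx n) (Idx n) k := mat (x : G n k)

/-- The space `V(λ) = H⁰(L / B_L, 𝓛(λ)) = Ind_{B_L}^L λ`, of the regular functions `f` on `L` with
`f(x b) = λ(b)⁻¹ f(x)` for all `x ∈ L` and `b ∈ B_L = B ∩ L`. -/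
def indRep (k : Type*) [Field k] (a : Fin n → ℤ) : Submodule k (↥(levi n k) → k) where
  carrier := {f | f ∈ regularFunctions (leviMat (n := n) (k := k)) ∧
    ∀ x b : ↥(levi n k), (b : G n k) ∈ borel n k → f (x * b) = (charVal a (b : G n k))⁻¹ * f x}
  zero_mem' := ⟨Subalgebra.zero_mem _, by simp⟩
  add_mem' := fun {f g} hf hg => ⟨Subalgebra.add_mem _ hf.1 hg.1, fun x b hb => by
    simp [hf.2 x b hb, hg.2 x b hb, mul_add]⟩
  smul_mem' := fun r f hf => ⟨Subalgebra.smul_mem _ hf.1 r, fun x b hb => by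
    simp [hf.2 x b hb, mul_left_comm]⟩

/-- The action of `L` on `V(λ)`: `(l • f)(x) = f(l⁻¹ x)`. -/
def leviRep (k : Type*) [Field k] (a : Fin n → ℤ) :
    Representation k ↥(levi n k) ↥(indRep k a) where
  toFun l :=
    { toFun := fun f => ⟨fun x => (f : ↥(levi n k) → k) (l⁻¹ * x),
        regularFunctions_comp_mul_left _ (fun x => l⁻¹ * x) (leviMat l⁻¹) (fun _ => rfl) f.2.1,
        fun x b hb => by
          have := f.2.2 (l⁻¹ * x) b hb
          rwa [mul_assoc] at this⟩
      map_add' := fun _ _ => rfl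
      map_smul' := fun _ _ => rfl }
  map_one' := by
    ext f x
    simp
  map_mul' l l' := by
    ext f x
    simp [mul_assoc]

/-- The space `H⁰(G-Zip, 𝓥(λ))` of global sections of the automorphic vector bundle `𝓥(λ)` on
the stack `G-Zip = [E \ G]`: the regular maps `F : G → V(λ)` (sums of maps `g ↦ f(g) v` with `f`
regular on `G` and `v ∈ V(λ)`) such that `F(x g y⁻¹) = (x, y) • F(g)` for all `(x, y) ∈ E`, `E`
acting on `V(λ)` through `E → P → L`. -/
def zipSections (p : ℕ) (k : Type*) [Field k] [ExpChar k p] (a : Fin n → ℤ) :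
    Submodule k (G n k → ↥(indRep k a)) :=
  Submodule.span k {F | ∃ f ∈ regularFunctions (mat (n := n) (k := k)), ∃ v : ↥(indRep k a),
      F = fun g => f g • v} ⊓
  { carrier := {F | ∀ ε ∈ zipGroup n k p, ∀ g : G n k,
      F ((ε.1 : G n k) * g * (ε.2 : G n k)⁻¹) = leviRep k a (leviP n k ε.1) (F g)}
    zero_mem' := by simp
    add_mem' := fun {F F'} hF hF' ε hε g => by simp [hF ε hε g, hF' ε hε g]
    smul_mem' := fun r F hF ε hε g => by simp [hF ε hε g] }

end Sections

/-! ### The cones in `X^*(T) = ℤⁿ` -/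

section Cones

variable (p n : ℕ)

/-- The zip cone `C_zip = {λ | H⁰(G-Zip, 𝓥(λ)) ≠ 0}`. -/
def zipCone (k : Type*) [Field k] [ExpChar k p] : Set (Fin n → ℤ) :=
  {a | zipSections p k a ≠ ⊥}

/-- The `L`-dominant characters `X^*_{+,I}(T)`: the pairing of `λ` with the coroot of each simple
root `e_i - e_{i+1}` of `L` is nonnegative, that is, `a_1 ≥ a_2 ≥ ⋯ ≥ a_n`. -/
def dominantCone : Set (Fin n → ℤ) :=
  {a | ∀ i j : Fin n, (j : ℕ) = i + 1 →
    0 ≤ a ⬝ᵥ (Pi.single i 1 - Pi.single j 1 : Fin n → ℤ)}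

variable {n}

/-- The monomial cone `C_Σ`, s-generated by the `e_i - p e_j` for `(i, j) ∈ Σ`. -/
def monomialCone (S : Set (Fin n × Fin n)) : Set (Fin n → ℤ) :=
  sGenerated ((fun ij : Fin n × Fin n =>
    (Pi.single ij.1 1 - (p : ℤ) • Pi.single ij.2 1 : Fin n → ℤ)) '' S)

variable (n)

/-- The polynomial cone `C_pol`, s-generated by all the `e_i - p e_j`. -/
def polCone : Set (Fin n → ℤ) :=
  (sGenerated {v : Fin n → ℤ | ∃ i j : Fin n, v = Pi.single i 1 - (p : ℤ) • Pi.single j 1} :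
    AddSubmonoid (Fin n → ℤ))

variable {n}

/-- The Zariski open subsets of `M_n(k)`: the complements of the zero loci of ideals of
polynomials in the matrix entries. -/
def IsZariskiOpen {k : Type*} [Field k] (U : Set (Matrix (Fin n) (Fin n) k)) : Prop :=
  ∃ I : Ideal (MvPolynomial (Fin n × Fin n) k),
    U = {x | (fun ij : Fin n × Fin n => x ij.1 ij.2) ∉ MvPolynomial.zeroLocus k I}

/-- The set `M_Σ` of the matrices with support in `Σ`. -/
def supportedMatrices (k : Type*) [Field k] (S : Set (Fin n × Fin n)) :
    Set (Matrix (Fin n) (Fin n) k) :=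
  {x | ∀ i j, (i, j) ∉ S → x i j = 0}

/-- `Σ` is large: there is a nonempty Zariski open subset of `M_n` each element `x` of which is
moved into `M_Σ` by `x ↦ b x φ(b)⁻¹` for some `b ∈ B_L`. -/
def IsLarge (k : Type*) [Field k] [ExpChar k p] (S : Set (Fin n × Fin n)) : Prop :=
  ∃ U : Set (Matrix (Fin n) (Fin n) k), IsZariskiOpen U ∧ U.Nonempty ∧
    ∀ x ∈ U, ∃ b ∈ lowerBorel n k,
      (b : Matrix (Fin n) (Fin n) k) * x *
        (((frobGL p k b)⁻¹ : GL (Fin n) k) : Matrix (Fin n) (Fin n) k) ∈ supportedMatrices k S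

variable (n)

/-- `Σ_1 = {(i, j) | i ≥ j} ∪ {(i, n + 1 - i)}`. -/
def sigmaOne : Set (Fin n × Fin n) :=
  {ij | ij.2 ≤ ij.1} ∪ {ij | ij.2 = ij.1.rev}

/-- `Σ'_1 = {(i, j) | i > j} ∪ {(i, n + 1 - i)}`. -/
def sigmaOne' : Set (Fin n × Fin n) :=
  {ij | ij.2 < ij.1} ∪ {ij | ij.2 = ij.1.rev}

end Cones

end

end SympZip

namespace SympZip

open Matrix

noncomputable section

/-! ### Saturated cones -/

section SaturatedCones

variable {M : Type*} [AddCommGroup M]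

/-! Everything reduces to semi-invariant polynomials on `M_n(k)`. Let `F` be a nonzero section of
weight `λ` and put `f(g) = F(g)(1)`. The unipotent radicals of `P` and `Q` embed in `E` and act
trivially on `V(λ)`, so on the big cell, where the upper left block is invertible, `f` depends on
that block only. There `f` is a polynomial divided by a power of the determinant. The big cell is
dense and every matrix occurs as an upper left block, so the denominator cancels and `f(g) =
Q(corner g)` for a polynomial `Q` (`exists_polynomial_corner`). Equivariance under `L` and the
transformation rule under `B_L` give `Q ≠ 0` and `Q(b x φ(b)⁻¹) = λ(b) Q(x)`
(`exists_semiInvariant`).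

For `b` in the torus, the variable `x_ij` has weight `e_i - p e_j`, so every monomial of `Q` has
total weight `λ`. If `Σ` is large, a point where `Q` does not vanish can be moved into `M_Σ`, and
`Q` stays nonzero there; some monomial of `Q` then uses only variables indexed by `Σ`, so that `λ ∈
C_Σ` (`zipCone_subset_monomialCone`).

The set `Σ_1` is large by induction on the size, removing the outer border of the matrix
(`exists_lower_mul_eq`). Its diagonal generators already lie in the cone of `Σ_1'`. Finally `V(λ) ≠
0` forces `λ` to be dominant, by a computation in the `SL_2` of each pair `i < j`
(`le_of_mem_indRep`). -/

theorem saturation_mono {C D : Set M} (h : C ⊆ D) : saturation C ⊆ saturation D :=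
  fun _ ⟨m, hm, hx⟩ => ⟨m, hm, h hx⟩

theorem subset_sGenerated (S : Set M) : S ⊆ (sGenerated S : Set M) := fun x hx => by
  simp only [sGenerated, SetLike.mem_coe, AddSubmonoid.mem_sInf]
  exact fun C hC => hC.1 hx

theorem sGenerated_le {S : Set M} {C : AddSubmonoid M} (hS : S ⊆ (C : Set M))
    (hC : saturation (C : Set M) = (C : Set M)) : sGenerated S ≤ C :=
  sInf_le ⟨hS, hC⟩

theorem saturation_sGenerated_subset (S : Set M) :
    saturation (sGenerated S : Set M) ⊆ (sGenerated S : Set M) := by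
  rintro x ⟨m, hm, hx⟩
  simp only [sGenerated, SetLike.mem_coe, AddSubmonoid.mem_sInf] at hx ⊢
  exact fun C hC => by
    have h : x ∈ saturation (C : Set M) := ⟨m, hm, hx C hC⟩
    rw [hC.2] at h
    exact h

theorem saturation_sGenerated (S : Set M) :
    saturation (sGenerated S : Set M) = (sGenerated S : Set M) :=
  (saturation_sGenerated_subset S).antisymm fun x hx => ⟨1, le_rfl, by simpa using hx⟩

theorem saturation_subset_sGenerated {C S : Set M} (h : C ⊆ (sGenerated S : Set M)) :
    saturation C ⊆ (sGenerated S : Set M) :=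
  (saturation_mono h).trans (saturation_sGenerated_subset S)

end SaturatedCones

/-! ### Comparison of the monomial cones; saturation of the dominant cone -/

section Cones

variable (p : ℕ) {n : ℕ}

theorem mem_monomialCone {S : Set (Fin n × Fin n)} {ij : Fin n × Fin n} (h : ij ∈ S) :
    (Pi.single ij.1 1 - (p : ℤ) • Pi.single ij.2 1 : Fin n → ℤ) ∈ monomialCone p S :=
  subset_sGenerated _ ⟨ij, h, rfl⟩

theorem monomialCone_subset_polCone (S : Set (Fin n × Fin n)) :
    monomialCone p S ⊆ polCone p n := by
  refine sGenerated_le ?_ (saturation_sGenerated _)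
  rintro _ ⟨⟨i, j⟩, -, rfl⟩
  exact subset_sGenerated _ ⟨i, j, rfl⟩

/-- The diagonal generators of the cone of `Σ_1` are positive rational combinations of the
antidiagonal ones. -/
theorem monomialCone_sigmaOne_subset :
    monomialCone p (sigmaOne n) ⊆ monomialCone p (sigmaOne' n) := by
  refine sGenerated_le ?_ (saturation_sGenerated _)
  rintro _ ⟨⟨i, j⟩, hij, rfl⟩
  rcases hij with hij | hij
  · rcases (show j ≤ i from hij).lt_or_eq with h | rfl
    · exact mem_monomialCone p (ij := (i, j)) (Or.inl h)
    -- With `j' = j.rev`, the terms in `e_{j'}` cancel in `(e_j - p e_{j'}) + p (e_{j'} - p e_j) =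
    -- (1 - p²) e_j`, which is `p + 1` times `e_j - p e_j`.
    · refine saturation_sGenerated_subset _ ⟨p + 1, by omega, ?_⟩
      have h1 := mem_monomialCone p (S := sigmaOne' n) (ij := (j, j.rev)) (Or.inr rfl)
      have h2 := mem_monomialCone p (S := sigmaOne' n) (ij := (j.rev, j))
        (Or.inr (Fin.rev_rev j).symm)
      have h3 := AddSubmonoid.add_mem _ h1 (AddSubmonoid.nsmul_mem _ h2 p)
      have h4 : (p + 1) • (Pi.single j 1 - (p : ℤ) • Pi.single j 1 : Fin n → ℤ) =
          (Pi.single j 1 - (p : ℤ) • Pi.single j.rev 1) +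
            p • (Pi.single j.rev 1 - (p : ℤ) • Pi.single j 1) := by
        funext l
        simp
        ring
      exact h4 ▸ h3
  · exact mem_monomialCone p (ij := (i, j)) (Or.inr hij)

theorem saturation_dominantCone_subset :
    saturation (dominantCone n) ⊆ dominantCone n := by
  rintro a ⟨m, hm, ha⟩ i j hij
  have := ha i j hij
  rw [smul_dotProduct, nsmul_eq_mul] at this
  exact nonneg_of_mul_nonneg_right this (by exact_mod_cast hm)

end Cones

/-! ### The generic determinant -/

section Determinant

open MvPolynomial

variable {m k : Type*} [Fintype m] [DecidableEq m] [Field k]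

/-- Each term of the Leibniz expansion takes exactly one entry from every column, so no variable is
repeated in it. -/
theorem degreeOf_det_mvPolynomialX_le (ij : m × m) :
    degreeOf ij (det (mvPolynomialX m m k)) ≤ 1 := by
  rw [det_apply]
  refine (degreeOf_sum_le _ _ _).trans (Finset.sup_le fun σ _ => ?_)
  have h1 : degreeOf ij (∏ i, mvPolynomialX m m k (σ i) i) ≤ 1 := by
    refine (degreeOf_prod_le _ _ _).trans ?_
    calc ∑ i, degreeOf ij (mvPolynomialX m m k (σ i) i)
        ≤ ∑ i, if i = ij.2 then 1 else 0 := by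
          refine Finset.sum_le_sum fun i _ => ?_
          rw [mvPolynomialX_apply, degreeOf_X]
          by_cases h : ij = (σ i, i)
          · rw [if_pos h, if_pos (by rw [h])]
          · rw [if_neg h]
            exact Nat.zero_le _
      _ ≤ 1 := by simp
  rcases Int.units_eq_one_or (Equiv.Perm.sign σ) with h | h <;> rw [h]
  · simpa using h1
  · simpa using h1

/-- If `a²` divides the determinant, then twice the degree of `a` in each variable is at most 1, so
`a` is constant. Squarefreeness is all that the Nullstellensatz argument below requires;
irreducibility is not needed. -/
theorem squarefree_det_mvPolynomialX : Squarefree (det (mvPolynomialX m m k)) := by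
  rintro a ⟨b, hab⟩
  have h0 := det_mvPolynomialX_ne_zero m k
  have ha : a ≠ 0 := by rintro rfl; exact h0 (hab.trans (by ring))
  have hb : b ≠ 0 := by rintro rfl; exact h0 (hab.trans (by ring))
  have hdeg : ∀ ij, degreeOf ij a = 0 := fun ij => by
    have := degreeOf_det_mvPolynomialX_le (k := k) ij
    rw [hab, degreeOf_mul_eq (mul_ne_zero ha ha) hb, degreeOf_mul_eq ha ha] at this
    omega
  have htot : a.totalDegree = 0 := by
    rw [totalDegree_eq_zero_iff]
    exact fun d hd ij => Nat.le_zero.1 ((degreeOf_le_iff.1 (hdeg ij).le) d hd)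
  rw [totalDegree_eq_zero_iff_eq_C] at htot
  rw [htot]
  refine IsUnit.map C (IsUnit.mk0 _ fun h => ha ?_)
  rw [htot, h, C_0]

/-- A polynomial that vanishes on all singular matrices is divisible by the determinant. -/
theorem det_dvd_of_vanishing [IsAlgClosed k] {Q : MvPolynomial (m × m) k}
    (hQ : ∀ A : Matrix m m k, A.det = 0 → eval (fun ij => A ij.1 ij.2) Q = 0) :
    det (mvPolynomialX m m k) ∣ Q := by
  have hrad : Q ∈ (Ideal.span {det (mvPolynomialX m m k)}).radical := by
    rw [← vanishingIdeal_zeroLocus_eq_radical (K := k), mem_vanishingIdeal_iff]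
    intro s hs
    have h1 := (mem_zeroLocus_iff.1 hs) _ (Ideal.mem_span_singleton_self _)
    rw [aeval_eq_eval] at h1 ⊢
    have h2 := hQ (Matrix.of fun i j => s (i, j)) ((eval_det_mvPolynomialX m k s).symm.trans h1)
    simpa only [Matrix.of_apply, Prod.mk.eta] using h2
  obtain ⟨e, he⟩ := hrad
  rw [Ideal.mem_span_singleton] at he
  -- The exponent `e` given by the radical may be 0, hence the passage to `e + 1`.
  exact (squarefree_det_mvPolynomialX.dvd_pow_iff_dvd (n := e + 1) (by omega)).1
    (he.trans (pow_dvd_pow _ (by omega)))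

/-- A function on `GL_n` that becomes polynomial after multiplication by a power of the
determinant is polynomial as soon as the polynomials it produces vanish on singular matrices. -/
theorem exists_polynomial_of_mul_det_pow [IsAlgClosed k] (h : GL m k → k)
    (hvan : ∀ (N : ℕ) (Q : MvPolynomial (m × m) k),
      (∀ A : GL m k, h A * (A : Matrix m m k).det ^ (N + 1) =
        eval (fun ij => (A : Matrix m m k) ij.1 ij.2) Q) →
      ∀ A : Matrix m m k, A.det = 0 → eval (fun ij => A ij.1 ij.2) Q = 0) :
    ∀ (N : ℕ) (Q : MvPolynomial (m × m) k),
      (∀ A : GL m k, h A * (A : Matrix m m k).det ^ N =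
        eval (fun ij => (A : Matrix m m k) ij.1 ij.2) Q) →
      ∃ Q₀ : MvPolynomial (m × m) k,
        ∀ A : GL m k, h A = eval (fun ij => (A : Matrix m m k) ij.1 ij.2) Q₀
  | 0, Q, hQ => ⟨Q, fun A => by simpa using hQ A⟩
  | N + 1, Q, hQ => by
    obtain ⟨Q', rfl⟩ := det_dvd_of_vanishing (hvan N Q hQ)
    refine exists_polynomial_of_mul_det_pow h hvan N Q' fun A => ?_
    have hA : (A : Matrix m m k).det ≠ 0 := ((isUnit_iff_isUnit_det _).1 A.isUnit).ne_zero
    have h1 := hQ A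
    rw [map_mul, eval_det_mvPolynomialX, pow_succ'] at h1
    refine mul_left_cancel₀ hA (Eq.trans ?_ h1)
    ring

end Determinant


/-! ### The subset `Σ_1` is large -/

section Large

open MvPolynomial

/-- The vector of length `n + 2` with first entry `a`, last entry `b` and the entries of `v` in
between. -/
def bordered {α : Type*} {n : ℕ} (a : α) (v : Fin n → α) (b : α) : Fin (n + 2) → α :=
  Fin.cons a (Fin.snoc (α := fun _ => α) v b)

/-- The inner indices of `Fin (n + 2)`. -/
abbrev inner {n : ℕ} (i : Fin n) : Fin (n + 2) := i.castSucc.succ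

/-- The last index of `Fin (n + 2)`. -/
abbrev outer (n : ℕ) : Fin (n + 2) := (Fin.last n).succ

section

variable {n : ℕ}

theorem bordered_zero {α : Type*} (a : α) (v : Fin n → α) (b : α) : bordered a v b 0 = a := rfl

theorem bordered_inner {α : Type*} (a : α) (v : Fin n → α) (b : α) (i : Fin n) :
    bordered a v b (inner i) = v i := by simp [bordered]

theorem bordered_outer {α : Type*} (a : α) (v : Fin n → α) (b : α) :
    bordered a v b (outer n) = b := by
  simp only [bordered, outer, Fin.cons_succ, Fin.snoc_last]

theorem sum_bordered {α : Type*} [AddCommMonoid α] (f : Fin (n + 2) → α) :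
    ∑ l, f l = f 0 + ((∑ l, f (inner l)) + f (outer n)) := by
  rw [Fin.sum_univ_succ, Fin.sum_univ_castSucc]

theorem forall_bordered {P : Fin (n + 2) → Prop} :
    (∀ i, P i) ↔ P 0 ∧ (∀ i, P (inner i)) ∧ P (outer n) :=
  ⟨fun h => ⟨h _, fun _ => h _, h _⟩, fun ⟨h0, h1, h2⟩ i =>
    Fin.cases h0 (fun j => Fin.lastCases h2 h1 j) i⟩

end

variable {k : Type*} [Field k]

theorem eval_bind₁ {σ τ : Type*} (s : τ → k) (f : σ → MvPolynomial τ k) (φ : MvPolynomial σ k) :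
    eval s (bind₁ f φ) = eval (fun i => eval s (f i)) φ := by
  simpa [aeval_eq_eval] using aeval_bind₁ s f φ

/-- With `c = b⁻¹`, the condition `b x φ(b)⁻¹ = y` reads `x φ(c) = c y`. The recursion goes from `n`
to `n + 2` because `Σ_1` without the outer border is again a `Σ_1`. The polynomial `D` records the
conditions met on the way: the upper right entry `α` is nonzero, and so is the earlier `D` at the
inner matrix `x'`, which is `α` times the Schur complement of `α`. The antidiagonal matrix satisfies
them at every stage, so the open set is nonempty. -/
theorem exists_lower_mul_eq [IsAlgClosed k] (p : ℕ) [ExpChar k p] : ∀ n : ℕ,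
    ∃ D : MvPolynomial (Fin n × Fin n) k,
      eval (fun ij => antiJ n k ij.1 ij.2) D ≠ 0 ∧
      ∀ x : Matrix (Fin n) (Fin n) k, eval (fun ij => x ij.1 ij.2) D ≠ 0 →
        ∃ c y : Matrix (Fin n) (Fin n) k, (∀ i j, i < j → c i j = 0) ∧ (∀ i, c i i ≠ 0) ∧
          y ∈ supportedMatrices k (sigmaOne n) ∧ x * c.map (frobenius k p) = c * y
  | 0 => ⟨1, by simp, fun _ _ => ⟨1, 1, fun i => i.elim0, fun i => i.elim0, fun i => i.elim0,
      Subsingleton.elim _ _⟩⟩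
  | 1 => ⟨1, by simp, fun x _ => ⟨1, x, fun i j h => by omega, fun i => by simp,
      fun i j h => absurd (Or.inl (show j ≤ i by omega)) h, by simp⟩⟩
  | n + 2 => by
    obtain ⟨D, hD, hc⟩ := exists_lower_mul_eq p n
    refine ⟨X (0, outer n) * bind₁ (fun ij => X (0, outer n) * X (inner ij.1, inner ij.2) -
      X (inner ij.1, outer n) * X (0, inner ij.2)) D, ?_, fun x hx => ?_⟩
    · rw [map_mul, eval_X, eval_bind₁]
      refine mul_ne_zero (by simp [antiJ, outer, Fin.succ_last]) ?_
      have h : (fun ij : Fin n × Fin n => eval (fun ij => antiJ (n + 2) k ij.1 ij.2)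
          (X (0, outer n) * X (inner ij.1, inner ij.2) -
            X (inner ij.1, outer n) * X (0, inner ij.2))) = fun ij => antiJ n k ij.1 ij.2 := by
        funext ij
        have h' : inner ij.2 = (inner ij.1).rev ↔ ij.2 = ij.1.rev := by
          simp only [Fin.ext_iff, inner, Fin.val_succ, Fin.val_castSucc, Fin.val_rev]
          omega
        simp [antiJ, h']
      rw [h]
      exact hD
    · rw [map_mul, eval_X, eval_bind₁] at hx
      have hα : x 0 (outer n) ≠ 0 := left_ne_zero_of_mul hx
      have hx' := right_ne_zero_of_mul hx
      set α := x 0 (outer n) with hαdef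
      set x' : Matrix (Fin n) (Fin n) k := Matrix.of fun i j =>
        α * x (inner i) (inner j) - x (inner i) (outer n) * x 0 (inner j) with hx'def
      obtain ⟨c', y', hc1, hc2, hy, hxc⟩ := hc x' (by
        convert hx' using 3
        simp [hx'def, hαdef])
      have hsurj : Function.Surjective (frobenius k p) := surjective_frobenius k p
      -- The inner entries of the top row of `x φ(c)` must vanish; this is the equation `∑ x_{0l}
      -- φ(c'_{lj}) + α φ(γ_j) = 0`.
      choose γ hγ using fun j => hsurj (-(∑ l, x 0 (inner l) * frobenius k p (c' l j)) / α)
      -- The last column of `c` is the last basis vector, so the last column of `x φ(c)` is that of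
      -- `x`. Taking this as the first column of `c` makes the last column of `y` equal to the first
      -- basis vector. The inner columns carry `c'`, with `γ` in the last row.
      set c : Matrix (Fin (n + 2)) (Fin (n + 2)) k := Matrix.of fun i j =>
        bordered (fun i => x i (outer n)) (fun l => bordered 0 (fun i => c' i l) (γ l))
          (bordered 0 0 1) j i with hcdef
      have c0 : ∀ i, c i 0 = x i (outer n) := fun i => rfl
      have c1 : ∀ i j, c i (inner j) = bordered 0 (fun i => c' i j) (γ j) i := fun i j => by
        rw [hcdef, Matrix.of_apply, bordered_inner]
      have c2 : ∀ i, c i (outer n) = bordered 0 0 1 i := fun i => by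
        rw [hcdef, Matrix.of_apply, bordered_outer]
      have hlow : ∀ i j, i < j → c i j = 0 := by
        simp only [forall_bordered, c0, c1, c2, bordered_inner, bordered_outer, bordered_zero]
        exact ⟨⟨fun h => absurd h (lt_irrefl _), fun _ _ => trivial, fun _ => trivial⟩,
          fun i => ⟨fun h => absurd h (Nat.not_lt_zero _), fun j h => hc1 i j (by simpa using h),
            fun _ => rfl⟩, fun h => absurd h (Nat.not_lt_zero _),
          fun i h => absurd h (by simp [Fin.lt_def]), fun h => absurd h (lt_irrefl _)⟩
      have hdiag : ∀ i, c i i ≠ 0 := by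
        simp only [forall_bordered, c0, c1, c2, bordered_inner, bordered_outer]
        exact ⟨hα, hc2, one_ne_zero⟩
      have hdet : IsUnit c.det := by
        rw [det_of_isLowerTriangular c fun i j h => hlow i j h]
        exact IsUnit.mk0 _ (Finset.prod_ne_zero_iff.2 fun i _ => hdiag i)
      -- The first column and the last row lie in `Σ_1`, so their entries are unconstrained and are
      -- chosen to solve the equation. The inner block is `α⁻¹ y'`, since eliminating `γ` turns the
      -- inner rows of `x φ(c)` into `α⁻¹ x' φ(c')`.
      set y : Matrix (Fin (n + 2)) (Fin (n + 2)) k := Matrix.of fun i j =>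
        bordered (c⁻¹ *ᵥ fun i => (x * c.map (frobenius k p)) i 0)
          (fun j => bordered 0 (fun i => α⁻¹ * y' i j)
            (∑ l, x (outer n) (inner l) * frobenius k p (c' l j) +
              x (outer n) (outer n) * frobenius k p (γ j) - ∑ l, γ l * (α⁻¹ * y' l j)))
          (bordered 1 0 0) j i with hydef
      have y0 : ∀ i, y i 0 = (c⁻¹ *ᵥ fun i => (x * c.map (frobenius k p)) i 0) i := fun i => rfl
      have y1 : ∀ i j, y i (inner j) = bordered 0 (fun i => α⁻¹ * y' i j)
          (∑ l, x (outer n) (inner l) * frobenius k p (c' l j) +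
              x (outer n) (outer n) * frobenius k p (γ j) - ∑ l, γ l * (α⁻¹ * y' l j)) i :=
        fun i j => by rw [hydef, Matrix.of_apply, bordered_inner]
      have y2 : ∀ i, y i (outer n) = bordered 1 0 0 i := fun i => by
        rw [hydef, Matrix.of_apply, bordered_outer]
      clear_value c y
      refine ⟨c, y, hlow, hdiag, ?_, ?_⟩
      · show ∀ i j, _
        simp only [forall_bordered, y1, y2, bordered_inner, bordered_outer, bordered_zero]
        have hi : ∀ i j : Fin n, (inner i, inner j) ∉ sigmaOne (n + 2) → (i, j) ∉ sigmaOne n := by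
          intro i j h h'
          refine h (h'.imp (fun h' => ?_) fun h' => ?_)
          · simpa using h'
          · have h' : j = i.rev := h'
            show inner j = (inner i).rev
            rw [h']
            simp only [Fin.ext_iff, inner, Fin.val_succ, Fin.val_castSucc, Fin.val_rev]
            omega
        have hl : ∀ i j : Fin (n + 2), j ≤ i → (i, j) ∉ sigmaOne (n + 2) → False :=
          fun i j h h' => h' (Or.inl h)
        have ha : (0, outer n) ∈ sigmaOne (n + 2) := Or.inr (by simp [outer, Fin.succ_last])
        refine ⟨⟨fun h => (hl _ _ le_rfl h).elim, fun _ _ => trivial, fun h => absurd ha h⟩,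
          fun i => ⟨fun h => (hl _ _ (Fin.zero_le _) h).elim, fun j h => ?_, fun _ => rfl⟩,
          fun h => (hl _ _ (Fin.zero_le _) h).elim, fun i h => (hl _ _ ?_ h).elim, fun _ => trivial⟩
        · rw [hy i j (hi i j h), mul_zero]
        · simp only [outer, inner, Fin.succ_le_succ_iff]
          exact Fin.le_last _
      · ext i j
        revert j
        rw [forall_bordered]
        refine ⟨?_, fun j => ?_, ?_⟩
        · have h := congrFun (Matrix.mulVec_mulVec (fun i => (x * c.map (frobenius k p)) i 0) c c⁻¹) i
          rw [mul_nonsing_inv _ hdet, one_mulVec] at h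
          rw [← h, mul_apply]
          simp only [y0]
          rfl
        · have hX : ∀ i, α * (∑ l, x (inner i) (inner l) * frobenius k p (c' l j)) -
              x (inner i) (outer n) * (∑ l, x 0 (inner l) * frobenius k p (c' l j)) =
              ∑ l, c' i l * y' l j := fun i => by
            have := congrFun (congrFun hxc i) j
            simp only [mul_apply, map_apply] at this
            rw [← this, Finset.mul_sum, Finset.mul_sum, ← Finset.sum_sub_distrib]
            refine Finset.sum_congr rfl fun l _ => ?_
            rw [hx'def, Matrix.of_apply]
            ring
          have hY : ∀ i, ∑ l, c' i l * (α⁻¹ * y' l j) = α⁻¹ * ∑ l, c' i l * y' l j := fun i => by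
            rw [Finset.mul_sum]
            exact Finset.sum_congr rfl fun l _ => by ring
          revert i
          simp only [forall_bordered, mul_apply, map_apply, sum_bordered, c0, c1, c2, y1,
            bordered_inner, bordered_outer, bordered_zero, map_zero, hγ]
          refine ⟨?_, fun i => ?_, ?_⟩
          · simp only [zero_mul, mul_zero, Finset.sum_const_zero, zero_add, add_zero]
            field_simp
            ring
          · rw [hY, ← hX]
            simp only [Pi.zero_apply, zero_mul, mul_zero, zero_add, add_zero]
            field_simp
            ring
          · ring
        · rw [mul_apply, mul_apply]
          simp only [sum_bordered, map_apply, c0, c1, c2, y2, bordered_inner, bordered_outer,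
            bordered_zero]
          simp

theorem isLarge_sigmaOne [IsAlgClosed k] (p : ℕ) [ExpChar k p] (n : ℕ) :
    IsLarge p k (sigmaOne n) := by
  obtain ⟨D, hD, h⟩ := exists_lower_mul_eq (k := k) p n
  refine ⟨{x | eval (fun ij => x ij.1 ij.2) D ≠ 0}, ⟨Ideal.span {D}, ?_⟩, ⟨antiJ n k, hD⟩,
    fun x hx => ?_⟩
  · ext x
    simp [zeroLocus_span, aeval_eq_eval]
  · obtain ⟨c, y, hlow, hdiag, hy, hxc⟩ := h x hx
    have hdet : c.det ≠ 0 := by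
      rw [det_of_isLowerTriangular c fun i j h => hlow i j h]
      exact Finset.prod_ne_zero_iff.2 fun i _ => hdiag i
    let g : GL (Fin n) k := GeneralLinearGroup.mkOfDetNeZero c hdet
    have hg : g ∈ lowerBorel n k := fun i j h => hlow i j h
    refine ⟨g⁻¹, Subgroup.inv_mem _ hg, ?_⟩
    have h1 : (((frobGL p k g⁻¹)⁻¹ : GL (Fin n) k) : Matrix (Fin n) (Fin n) k) =
        c.map (frobenius k p) := by
      rw [map_inv, inv_inv]
      rfl
    have h2 : ((g⁻¹ : GL (Fin n) k) : Matrix (Fin n) (Fin n) k) * c = 1 := Units.inv_mul g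
    rw [h1, Matrix.mul_assoc, hxc, ← Matrix.mul_assoc]
    rw [h2, Matrix.one_mul]
    exact hy

end Large


/-! ### Elements of the symplectic group -/

section Elements

variable {n : ℕ} {k : Type*} [Field k]

theorem antiJ_transpose : (antiJ n k)ᵀ = antiJ n k := by
  ext i j
  simp only [antiJ, transpose_apply, of_apply]
  congr 1
  exact propext ⟨fun h => by rw [h, Fin.rev_rev], fun h => by rw [h, Fin.rev_rev]⟩

theorem antiJ_mul_apply (M : Matrix (Fin n) (Fin n) k) (i j : Fin n) :
    (antiJ n k * M) i j = M i.rev j := by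
  simp [antiJ, mul_apply]

theorem mul_antiJ_apply (M : Matrix (Fin n) (Fin n) k) (i j : Fin n) :
    (M * antiJ n k) i j = M i j.rev := by
  rw [← transpose_transpose (M * antiJ n k), transpose_mul, antiJ_transpose, transpose_apply,
    antiJ_mul_apply, transpose_apply]

theorem antiJ_mul_antiJ : antiJ n k * antiJ n k = 1 := by
  ext i j
  rw [antiJ_mul_apply]
  simp [antiJ, one_apply, eq_comm]

theorem antiJ_mul_antiJ_mul (M : Matrix (Fin n) (Fin n) k) :
    antiJ n k * (antiJ n k * M) = M := by
  rw [← Matrix.mul_assoc, antiJ_mul_antiJ, Matrix.one_mul]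

theorem formPsi_mul_formPsi : formPsi n k * formPsi n k = -1 := by
  rw [← fromBlocks_one, fromBlocks_neg]
  simp [formPsi, fromBlocks_multiply, antiJ_mul_antiJ]

/-- The element of `G` with a given symplectic matrix. -/
def ofMatrix (M : Matrix (Idx n) (Idx n) k) (h : Mᵀ * formPsi n k * M = formPsi n k) : G n k :=
  -- Since `Ψ² = -1`, the relation `Mᵀ Ψ M = Ψ` exhibits `-Ψ Mᵀ Ψ` as the inverse of `M`.
  ⟨⟨M, -(formPsi n k * Mᵀ * formPsi n k), by
      rw [mul_eq_one_comm, neg_mul, Matrix.mul_assoc, Matrix.mul_assoc, ← Matrix.mul_assoc Mᵀ, h,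
        formPsi_mul_formPsi, neg_neg], by
      rw [neg_mul, Matrix.mul_assoc, Matrix.mul_assoc, ← Matrix.mul_assoc Mᵀ, h,
        formPsi_mul_formPsi, neg_neg]⟩, h⟩

theorem mat_ofMatrix (M : Matrix (Idx n) (Idx n) k) (h : Mᵀ * formPsi n k * M = formPsi n k) :
    mat (ofMatrix M h) = M := rfl

theorem mat_injective : Function.Injective (mat (n := n) (k := k)) :=
  fun _ _ h => Subtype.ext (Units.ext h)

theorem exists_blocks (g : G n k) : ∃ A B C D, mat g = fromBlocks A B C D :=
  ⟨_, _, _, _, (fromBlocks_toBlocks (mat g)).symm⟩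

/-- The relation satisfied by the blocks of a symplectic matrix. -/
theorem fromBlocks_form_iff {A B C D : Matrix (Fin n) (Fin n) k} :
    (fromBlocks A B C D)ᵀ * formPsi n k * fromBlocks A B C D = formPsi n k ↔
      Cᵀ * antiJ n k * A = Aᵀ * antiJ n k * C ∧ Dᵀ * antiJ n k * B = Bᵀ * antiJ n k * D ∧
        Aᵀ * antiJ n k * D - Cᵀ * antiJ n k * B = antiJ n k := by
  have key : ((Aᵀ * antiJ n k * D - Cᵀ * antiJ n k * B))ᵀ =
      Dᵀ * antiJ n k * A - Bᵀ * antiJ n k * C := by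
    simp [antiJ_transpose, Matrix.mul_assoc]
  simp only [formPsi, fromBlocks_transpose, fromBlocks_multiply, fromBlocks_inj,
    Matrix.mul_zero, zero_add, add_zero, Matrix.mul_neg, Matrix.neg_mul]
  constructor
  · rintro ⟨h1, h2, -, h4⟩
    exact ⟨by rw [← sub_eq_zero, sub_eq_add_neg]; exact h1,
      by rw [← sub_eq_zero, sub_eq_add_neg]; exact h4,
      by rw [← neg_inj, ← h2]; abel⟩
  · rintro ⟨h1, h2, h3⟩
    refine ⟨by rw [h1]; abel, by rw [← neg_inj, neg_neg]; nth_rewrite 3 [← h3]; abel, ?_,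
      by rw [h2]; abel⟩
    rw [h3, antiJ_transpose] at key
    nth_rewrite 3 [key]
    abel

/-- The isomorphism of `GL_n` with the Levi subgroup, as a homomorphism to `G`. -/
def leviHom : GL (Fin n) k →* G n k where
  toFun A := ofMatrix (fromBlocks A 0 0
    (antiJ n k * ((A⁻¹ : GL (Fin n) k) : Matrix (Fin n) (Fin n) k)ᵀ * antiJ n k)) <| by
      rw [fromBlocks_form_iff]
      refine ⟨by simp, by simp, ?_⟩
      rw [transpose_zero, Matrix.zero_mul, Matrix.zero_mul, sub_zero, Matrix.mul_assoc,
        Matrix.mul_assoc, antiJ_mul_antiJ_mul, ← Matrix.mul_assoc, ← transpose_mul,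
        Units.inv_mul, transpose_one, Matrix.one_mul]
  map_one' := mat_injective <| by
    simp [mat_ofMatrix, mat_one, antiJ_mul_antiJ]
  map_mul' A B := mat_injective <| by
    simp only [mat_ofMatrix, mat_mul, fromBlocks_multiply, _root_.mul_inv_rev, Units.val_mul,
      transpose_mul, Matrix.mul_assoc, antiJ_mul_antiJ_mul]
    simp

theorem mat_leviHom (A : GL (Fin n) k) : mat (leviHom A) = fromBlocks (A : Matrix _ _ k) 0 0
    (antiJ n k * ((A⁻¹ : GL (Fin n) k) : Matrix (Fin n) (Fin n) k)ᵀ * antiJ n k) := rfl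

theorem leviHom_mem_parP (A : GL (Fin n) k) : leviHom A ∈ parP n k :=
  mem_parP.2 (by rw [mat_leviHom, toBlocks_fromBlocks₁₂])

theorem leviHom_mem_parQ (A : GL (Fin n) k) : leviHom A ∈ parQ n k :=
  mem_parQ.2 (by rw [mat_leviHom, toBlocks_fromBlocks₂₁])

theorem leviHom_mem_levi (A : GL (Fin n) k) : leviHom A ∈ levi n k :=
  ⟨leviHom_mem_parP A, leviHom_mem_parQ A⟩

/-- An element of the Levi subgroup is determined by its upper left block. -/
theorem exists_leviHom_eq {g : G n k} (hg : g ∈ levi n k) :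
    ∃ A : GL (Fin n) k, leviHom A = g ∧ (A : Matrix _ _ k) = (mat g).toBlocks₁₁ := by
  obtain ⟨A, B, C, D, hM⟩ := exists_blocks g
  have hB := mem_parP.1 hg.1
  have hC := mem_parQ.1 hg.2
  rw [hM, toBlocks_fromBlocks₁₂] at hB
  rw [hM, toBlocks_fromBlocks₂₁] at hC
  subst hB hC
  have h := mat_form g
  rw [hM, fromBlocks_form_iff] at h
  have h3 : Aᵀ * antiJ n k * D = antiJ n k := by simpa using h.2.2
  have h4 : Aᵀ * (antiJ n k * D * antiJ n k) = 1 := by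
    rw [← Matrix.mul_assoc, ← Matrix.mul_assoc, h3, antiJ_mul_antiJ]
  have h5 : (antiJ n k * D * antiJ n k)ᵀ * A = 1 := by
    rw [← transpose_transpose A, ← transpose_mul, h4, transpose_one]
  refine ⟨⟨A, (antiJ n k * D * antiJ n k)ᵀ, mul_eq_one_comm.1 h5, h5⟩, mat_injective ?_, ?_⟩
  · rw [hM, mat_leviHom, Units.inv_mk]
    simp [Matrix.mul_assoc, antiJ_mul_antiJ_mul, antiJ_mul_antiJ]
  · rw [hM, toBlocks_fromBlocks₁₁]

/-- The elements of the unipotent radical of `P`. -/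
def lowerUnipotent (X : Matrix (Fin n) (Fin n) k) (hX : Xᵀ * antiJ n k = antiJ n k * X) : G n k :=
  ofMatrix (fromBlocks 1 0 X 1) <| by
    rw [fromBlocks_form_iff]
    simp [hX]

/-- A symplectic matrix with a given symmetric upper left block. -/
def ofSymmetric (D : Matrix (Fin n) (Fin n) k) (hD : Dᵀ = D) : G n k :=
  ofMatrix (fromBlocks D (-antiJ n k) (antiJ n k) 0) <| by
    rw [fromBlocks_form_iff]
    simp [hD, antiJ_transpose, antiJ_mul_antiJ, Matrix.mul_assoc]

theorem charVal_leviHom (a : Fin n → ℤ) (b : GL (Fin n) k) :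
    charVal a (leviHom b) = ∏ i, (b : Matrix _ _ k) i i ^ a i := rfl

/-- Transposition and the reversal of both indices each exchange upper and lower triangular
matrices, so the block `J (b⁻¹)ᵀ J` is again lower triangular. -/
theorem leviHom_mem_borel {b : GL (Fin n) k} (hb : b ∈ lowerBorel n k) : leviHom b ∈ borel n k := by
  have hb' := Subgroup.inv_mem _ hb
  rintro (i | i) (j | j) h
  · exact hb (by simpa using h)
  · rfl
  · exfalso
    simp only [OrderDual.toDual_lt_toDual, Sum.elim_inl, Sum.elim_inr] at h
    omega
  · show (antiJ n k * ((b⁻¹ : GL (Fin n) k) : Matrix (Fin n) (Fin n) k)ᵀ * antiJ n k) i j = 0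
    rw [mul_antiJ_apply, antiJ_mul_apply, transpose_apply]
    exact hb' (by simpa using h)

end Elements


/-! ### Regular functions along curves, and density of the big cell -/

section Regular

variable {n : ℕ} {k : Type*} [Field k]

/-- A regular function is polynomial along an affine curve. -/
theorem exists_polynomial_of_affine {X m : Type*} {c : X → Matrix m m k} {f : X → k}
    (hf : f ∈ regularFunctions c) (γ : k → X) (M N : Matrix m m k)
    (hγ : ∀ t, c (γ t) = M + t • N) : ∃ q : Polynomial k, ∀ t, f (γ t) = q.eval t := by
  unfold regularFunctions at hf
  induction hf using Algebra.adjoin_induction with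
  | mem f hf =>
    obtain ⟨⟨i, j⟩, rfl⟩ := hf
    refine ⟨Polynomial.C (M i j) + Polynomial.X * Polynomial.C (N i j), fun t => ?_⟩
    simp [hγ]
    ring
  | algebraMap r => exact ⟨Polynomial.C r, fun t => by simp⟩
  | add f g _ _ hf hg =>
    obtain ⟨q, hq⟩ := hf
    obtain ⟨r, hr⟩ := hg
    exact ⟨q + r, fun t => by simp [hq, hr]⟩
  | mul f g _ _ hf hg =>
    obtain ⟨q, hq⟩ := hf
    obtain ⟨r, hr⟩ := hg
    exact ⟨q * r, fun t => by simp [hq, hr]⟩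

/-- The upper left block of an element of `G`. -/
def corner (g : G n k) : Matrix (Fin n) (Fin n) k := (mat g).toBlocks₁₁

theorem corner_leviHom_mul_mul (A B : GL (Fin n) k) (g : G n k) :
    corner (leviHom A * g * leviHom B) = (A : Matrix _ _ k) * corner g * (B : Matrix _ _ k) := by
  obtain ⟨M, N, P, Q, h⟩ := exists_blocks g
  simp [corner, mat_mul, h, mat_leviHom, fromBlocks_multiply]

theorem eval_corner_mem_regularFunctions (Q : MvPolynomial (Fin n × Fin n) k) :
    (fun g : G n k => MvPolynomial.eval (fun ij => corner g ij.1 ij.2) Q) ∈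
      regularFunctions (mat (n := n) (k := k)) := by
  induction Q using MvPolynomial.induction_on with
  | C a =>
    simp only [MvPolynomial.eval_C]
    exact Subalgebra.algebraMap_mem (regularFunctions mat) a
  | add P Q hP hQ =>
    simp only [map_add]
    exact Subalgebra.add_mem _ hP hQ
  | mul_X P ij hP =>
    simp only [map_mul, MvPolynomial.eval_X]
    exact Subalgebra.mul_mem _ hP
      (Algebra.subset_adjoin ⟨(Sum.inl ij.1, Sum.inl ij.2), rfl⟩)

/-- The left inverse `-Ψ Mᵀ Ψ` of `M` is also a right inverse. This provides the relations between
the blocks in a row of `M`, where the definition gives those between the blocks in a column. -/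
theorem transpose_form {M : Matrix (Idx n) (Idx n) k} (h : Mᵀ * formPsi n k * M = formPsi n k) :
    Mᵀᵀ * formPsi n k * Mᵀ = formPsi n k := by
  have h1 : -(formPsi n k * Mᵀ * formPsi n k) * M = 1 := by
    rw [neg_mul, Matrix.mul_assoc, Matrix.mul_assoc, ← Matrix.mul_assoc Mᵀ, h,
      formPsi_mul_formPsi, neg_neg]
  rw [mul_eq_one_comm] at h1
  calc Mᵀᵀ * formPsi n k * Mᵀ
      = M * -(formPsi n k * Mᵀ * formPsi n k) * formPsi n k := by
        simp only [transpose_transpose, Matrix.mul_assoc, Matrix.mul_neg, Matrix.neg_mul,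
          formPsi_mul_formPsi, Matrix.mul_one, neg_neg]
    _ = formPsi n k := by rw [h1, Matrix.one_mul]

/-- Every matrix is equivalent to a symmetric idempotent one. -/
theorem exists_symmetric_idempotent (A : Matrix (Fin n) (Fin n) k) :
    ∃ (U V : GL (Fin n) k) (E : Matrix (Fin n) (Fin n) k), Eᵀ = E ∧ E * E = E ∧
      (U : Matrix _ _ k) * A * (V : Matrix _ _ k) = E := by
  obtain ⟨U, V, e, ⟨U', rfl⟩, ⟨V', rfl⟩, h⟩ := exists_rank_normal_form A
  refine ⟨U', V', _, ?_, ?_, h⟩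
  · rw [transpose_submatrix, fromBlocks_transpose]
    simp
  · rw [submatrix_mul_equiv, fromBlocks_multiply]
    simp

/-- Every matrix is the upper left block of an element of `G`. -/
theorem corner_surjective : Function.Surjective (corner (n := n) (k := k)) := fun A => by
  obtain ⟨U, V, E, hE, -, h⟩ := exists_symmetric_idempotent A
  refine ⟨leviHom U⁻¹ * ofSymmetric E hE * leviHom V⁻¹, ?_⟩
  rw [corner_leviHom_mul_mul]
  have h1 : corner (ofSymmetric E hE) = E := by
    rw [corner, ofSymmetric, mat_ofMatrix, toBlocks_fromBlocks₁₁]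
  rw [h1, ← h, ← Matrix.mul_assoc, ← Matrix.mul_assoc, Units.inv_mul, Matrix.one_mul,
    Matrix.mul_assoc, Units.mul_inv, Matrix.mul_one]

/-- Every element of `G` whose upper left block is a symmetric idempotent lies on an affine curve
that meets the big cell. -/
theorem exists_lowerUnipotent_of_idempotent (g : G n k) (hs : (corner g)ᵀ = corner g)
    (hi : corner g * corner g = corner g) :
    ∃ (X : Matrix (Fin n) (Fin n) k) (hX : Xᵀ * antiJ n k = antiJ n k * X),
      (corner (g * lowerUnipotent X hX)).det ≠ 0 := by
  obtain ⟨E, B, C, D, hM⟩ := exists_blocks g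
  have hE : corner g = E := by rw [corner, hM, toBlocks_fromBlocks₁₁]
  rw [hE] at hs hi
  have h := transpose_form (mat_form g)
  rw [hM, fromBlocks_transpose, fromBlocks_form_iff] at h
  obtain ⟨h1, -, h3⟩ := h
  simp only [transpose_transpose, hs] at h1 h3
  refine ⟨antiJ n k * (1 - E), by
    simp [antiJ_transpose, hs, Matrix.mul_assoc, antiJ_mul_antiJ, antiJ_mul_antiJ_mul], ?_⟩
  have hcor : corner (g * lowerUnipotent (antiJ n k * (1 - E)) (by
      simp [antiJ_transpose, hs, Matrix.mul_assoc, antiJ_mul_antiJ, antiJ_mul_antiJ_mul])) =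
      E + B * antiJ n k * (1 - E) := by
    rw [corner, mat_mul, hM, lowerUnipotent, mat_ofMatrix, fromBlocks_multiply,
      toBlocks_fromBlocks₁₁, Matrix.mul_one, Matrix.mul_assoc]
  rw [hcor]
  intro hdet
  obtain ⟨w, hw, h0⟩ := exists_vecMul_eq_zero_iff.2 hdet
  -- Multiplying on the right by `E` kills `1 - E` and leaves `w E = 0`. Then `B J E = E J Bᵀ`
  -- yields `w B J = 0`, and `E J Dᵀ - B J Cᵀ = J` yields `w J = 0`, so `w = 0`.
  have hwE : w ᵥ* E = 0 := by
    have := congrArg (· ᵥ* E) h0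
    simpa [vecMul_vecMul, Matrix.add_mul, Matrix.sub_mul, Matrix.mul_assoc, hi] using this
  have hwB : w ᵥ* (B * antiJ n k) = 0 := by
    rw [Matrix.mul_sub, Matrix.mul_one, vecMul_add, vecMul_sub, hwE, h1, Matrix.mul_assoc,
      ← vecMul_vecMul w E, hwE, zero_vecMul] at h0
    simpa using h0
  refine hw ?_
  have hJ : w ᵥ* antiJ n k = 0 := by
    rw [← h3, vecMul_sub, Matrix.mul_assoc, ← vecMul_vecMul w E, hwE, ← vecMul_vecMul w (B * antiJ n k), hwB]
    simp
  rw [← vecMul_one w, ← antiJ_mul_antiJ, ← vecMul_vecMul, hJ, zero_vecMul]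

/-- The big cell, where the upper left block is invertible, is dense in `G`. -/
theorem eq_zero_of_vanishing_on_bigCell [Infinite k] {f : G n k → k}
    (hf : f ∈ regularFunctions (mat (n := n) (k := k)))
    (h : ∀ g, (corner g).det ≠ 0 → f g = 0) (g : G n k) : f g = 0 := by
  obtain ⟨U, V, E, hE, hEE, hUV⟩ := exists_symmetric_idempotent (corner g)
  have hcor : corner (leviHom U * g * leviHom V) = E := by rw [corner_leviHom_mul_mul, hUV]
  obtain ⟨X, hX, hdet⟩ := exists_lowerUnipotent_of_idempotent (leviHom U * g * leviHom V)
    (by rw [hcor, hE]) (by rw [hcor, hEE])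
  have hX' : ∀ t : k, (t • X)ᵀ * antiJ n k = antiJ n k * (t • X) := fun t => by
    rw [transpose_smul, Matrix.smul_mul, hX, Matrix.mul_smul]
  -- This affine line passes through `g` at `t = 0` and through the big cell at `t = 1`. Along it
  -- `f` and the determinant of the corner are polynomials `q` and `d` with `q d = 0` and `d ≠ 0`.
  let γ : k → G n k := fun t =>
    leviHom U⁻¹ * (leviHom U * g * leviHom V * lowerUnipotent (t • X) (hX' t)) * leviHom V⁻¹
  have hγ : ∀ t, mat (γ t) = mat g + t •
      (mat (leviHom U⁻¹ * (leviHom U * g * leviHom V)) * fromBlocks 0 0 X 0 *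
        mat (leviHom V⁻¹)) := fun t => by
    have h1 : mat (lowerUnipotent (t • X) (hX' t)) = 1 + t • fromBlocks 0 0 X 0 := by
      rw [lowerUnipotent, mat_ofMatrix, ← fromBlocks_one, fromBlocks_smul, fromBlocks_add]
      simp
    have h2 : mat (leviHom U⁻¹ * (leviHom U * g * leviHom V)) * mat (leviHom V⁻¹) = mat g := by
      rw [← mat_mul, map_inv, map_inv]
      congr 1
      group
    calc mat (γ t) = mat (leviHom U⁻¹ * (leviHom U * g * leviHom V)) *
          mat (lowerUnipotent (t • X) (hX' t)) * mat (leviHom V⁻¹) := by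
          rw [← mat_mul, ← mat_mul, mul_assoc (leviHom U⁻¹)]
      _ = _ := by
          rw [h1, Matrix.mul_add, Matrix.mul_one, Matrix.add_mul, h2, Matrix.mul_smul,
            Matrix.smul_mul]
  obtain ⟨q, hq⟩ := exists_polynomial_of_affine hf γ _ _ hγ
  obtain ⟨d, hd⟩ := exists_polynomial_of_affine
    (eval_corner_mem_regularFunctions (det (mvPolynomialX (Fin n) (Fin n) k))) γ _ _ hγ
  have hd' : ∀ t, (corner (γ t)).det = d.eval t := fun t => by
    rw [← hd, eval_det_mvPolynomialX]
    rfl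
  have hd1 : d.eval 1 ≠ 0 := by
    rw [← hd', corner_leviHom_mul_mul, det_mul, det_mul]
    have hu : ∀ W : GL (Fin n) k, (W : Matrix (Fin n) (Fin n) k).det ≠ 0 := fun W =>
      ((isUnit_iff_isUnit_det _).1 W.isUnit).ne_zero
    refine mul_ne_zero (mul_ne_zero (hu _) ?_) (hu _)
    simpa only [one_smul] using hdet
  have hqd : q * d = 0 := Polynomial.funext fun t => by
    rw [Polynomial.eval_mul, Polynomial.eval_zero]
    by_cases ht : d.eval t = 0
    · rw [ht, mul_zero]
    · rw [← hq, h _ (by rwa [hd']), zero_mul]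
  have hq0 : q = 0 := (mul_eq_zero.1 hqd).resolve_right fun h0 => hd1 (by simp [h0])
  have hg : γ 0 = g := mat_injective (by rw [hγ, zero_smul, add_zero])
  rw [← hg, hq, hq0, Polynomial.eval_zero]

/-- The restriction of a regular function to `GL_n` is polynomial up to a power of the
determinant. -/
theorem exists_leviHom_mul_det_pow_eq {f : G n k → k}
    (hf : f ∈ regularFunctions (mat (n := n) (k := k))) :
    ∃ (N : ℕ) (Q : MvPolynomial (Fin n × Fin n) k), ∀ A : GL (Fin n) k,
      f (leviHom A) * (A : Matrix (Fin n) (Fin n) k).det ^ N =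
        MvPolynomial.eval (fun ij => (A : Matrix _ _ k) ij.1 ij.2) Q := by
  have hdet : ∀ A : Matrix (Fin n) (Fin n) k, MvPolynomial.eval (fun ij => A ij.1 ij.2)
      (det (mvPolynomialX (Fin n) (Fin n) k)) = A.det := fun A => by
    rw [eval_det_mvPolynomialX]
    rfl
  unfold regularFunctions at hf
  induction hf using Algebra.adjoin_induction with
  | mem f hf =>
    obtain ⟨⟨i | i, j | j⟩, rfl⟩ := hf
    · exact ⟨0, MvPolynomial.X (i, j), fun A => by simp [mat_leviHom]⟩
    · exact ⟨0, 0, fun A => by simp [mat_leviHom]⟩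
    · exact ⟨0, 0, fun A => by simp [mat_leviHom]⟩
    -- The lower right block is `J (A⁻¹)ᵀ J`, whose entries are those of the adjugate divided by one
    -- determinant.
    · refine ⟨1, (mvPolynomialX (Fin n) (Fin n) k).adjugate j.rev i.rev, fun A => ?_⟩
      have hA := (isUnit_iff_isUnit_det _).1 A.isUnit
      have h1 : mat (leviHom A) (Sum.inr i) (Sum.inr j) = (A : Matrix _ _ k)⁻¹ j.rev i.rev := by
        rw [mat_leviHom, fromBlocks_apply₂₂, mul_antiJ_apply, antiJ_mul_apply, transpose_apply,
          coe_units_inv]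
      have h2 : MvPolynomial.eval (fun ij => (A : Matrix _ _ k) ij.1 ij.2)
          ((mvPolynomialX (Fin n) (Fin n) k).adjugate j.rev i.rev) =
          (A : Matrix _ _ k).adjugate j.rev i.rev := by
        rw [← mvPolynomialX_mapMatrix_eval (A : Matrix (Fin n) (Fin n) k), ← RingHom.map_adjugate,
          mvPolynomialX_mapMatrix_eval]
        rfl
      simp only [h1, h2]
      rw [inv_def, Matrix.smul_apply, smul_eq_mul, pow_one, mul_comm, ← mul_assoc,
        Ring.mul_inverse_cancel _ hA, one_mul]
  | algebraMap r => exact ⟨0, MvPolynomial.C r, fun A => by simp⟩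
  | add f g _ _ hf hg =>
    obtain ⟨N, Q, hQ⟩ := hf
    obtain ⟨N', Q', hQ'⟩ := hg
    refine ⟨N + N', Q * det (mvPolynomialX (Fin n) (Fin n) k) ^ N' +
      Q' * det (mvPolynomialX (Fin n) (Fin n) k) ^ N, fun A => ?_⟩
    simp only [map_add, map_mul, map_pow, hdet, ← hQ, ← hQ', Pi.add_apply]
    ring
  | mul f g _ _ hf hg =>
    obtain ⟨N, Q, hQ⟩ := hf
    obtain ⟨N', Q', hQ'⟩ := hg
    refine ⟨N + N', Q * Q', fun A => ?_⟩
    simp only [map_mul, ← hQ, ← hQ', Pi.mul_apply]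
    ring

/-- A regular function on `G` that only depends on the upper left block on the big cell is a
polynomial in the upper left block. -/
theorem exists_polynomial_corner [IsAlgClosed k] {f : G n k → k}
    (hf : f ∈ regularFunctions (mat (n := n) (k := k)))
    (hinv : ∀ (g : G n k) (A : GL (Fin n) k), corner g = (A : Matrix _ _ k) →
      f g = f (leviHom A)) :
    ∃ Q : MvPolynomial (Fin n × Fin n) k,
      ∀ g, f g = MvPolynomial.eval (fun ij => corner g ij.1 ij.2) Q := by
  have hdet : ∀ g : G n k, MvPolynomial.eval (fun ij => corner g ij.1 ij.2)
      (det (mvPolynomialX (Fin n) (Fin n) k)) = (corner g).det := fun A => by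
    rw [eval_det_mvPolynomialX]
    rfl
  -- By density of the big cell, such an identity extends from `GL_n` to all of `G`, including the
  -- elements with singular corner.
  have hext : ∀ (N : ℕ) (Q : MvPolynomial (Fin n × Fin n) k),
      (∀ A : GL (Fin n) k, f (leviHom A) * (A : Matrix (Fin n) (Fin n) k).det ^ N =
        MvPolynomial.eval (fun ij => (A : Matrix _ _ k) ij.1 ij.2) Q) →
      ∀ g, f g * (corner g).det ^ N =
        MvPolynomial.eval (fun ij => corner g ij.1 ij.2) Q := by
    intro N Q hQ g
    rw [← sub_eq_zero, ← hdet, ← map_pow]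
    refine eq_zero_of_vanishing_on_bigCell (f := fun g => f g *
      MvPolynomial.eval (fun ij => corner g ij.1 ij.2)
        (det (mvPolynomialX (Fin n) (Fin n) k) ^ N) -
      MvPolynomial.eval (fun ij => corner g ij.1 ij.2) Q)
      (Subalgebra.sub_mem _ (Subalgebra.mul_mem _ hf (eval_corner_mem_regularFunctions _))
        (eval_corner_mem_regularFunctions _)) (fun g hg => ?_) g
    have hA : corner g = ((GeneralLinearGroup.mkOfDetNeZero (corner g) hg : GL (Fin n) k) :
      Matrix _ _ k) := rfl
    have := hQ (GeneralLinearGroup.mkOfDetNeZero (corner g) hg)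
    rw [← hinv g _ hA, ← hA] at this
    simp only [map_pow, hdet]
    rw [this, sub_self]
  obtain ⟨N, Q, hQ⟩ := exists_leviHom_mul_det_pow_eq hf
  obtain ⟨Q₀, hQ₀⟩ := exists_polynomial_of_mul_det_pow (fun A => f (leviHom A))
    -- Every singular `A` is the corner of some `g`, where `f g` is a finite value; hence `Q(A) = f
    -- g * 0 = 0`.
    (fun N Q hQ A hA => by
      obtain ⟨g, rfl⟩ := corner_surjective A
      rw [← hext _ Q hQ g, hA, zero_pow (Nat.succ_ne_zero N), mul_zero]) N Q hQ
  exact ⟨Q₀, fun g => by simpa using hext 0 Q₀ (fun A => by simpa using hQ₀ A) g⟩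

end Regular


/-! ### Semi-invariant polynomials attached to sections -/

section SemiInvariant

variable {n : ℕ} {k : Type*} [Field k]

theorem leviToGL_leviP (x : ↥(parP n k)) :
    ((leviToGL n k (leviP n k x) : GL (Idx n) k) : Matrix (Idx n) (Idx n) k) = blockDiag (mat (x : G n k)) :=
  rfl

theorem leviToGL_leviQ (x : ↥(parQ n k)) :
    ((leviToGL n k (leviQ n k x) : GL (Idx n) k) : Matrix (Idx n) (Idx n) k) = blockDiag (mat (x : G n k)) :=
  rfl

theorem leviToGL_injective : Function.Injective (leviToGL n k) :=
  fun _ _ h => Subtype.ext (Subtype.ext h)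

theorem leviP_leviHom (A : GL (Fin n) k) :
    leviP n k ⟨leviHom A, leviHom_mem_parP A⟩ = ⟨leviHom A, leviHom_mem_levi A⟩ := by
  refine leviToGL_injective (Units.ext ?_)
  rw [leviToGL_leviP]
  show blockDiag (mat (leviHom A)) = mat (leviHom A)
  rw [mat_leviHom, blockDiag, toBlocks_fromBlocks₁₁, toBlocks_fromBlocks₂₂]

theorem leviQ_leviHom (A : GL (Fin n) k) :
    leviQ n k ⟨leviHom A, leviHom_mem_parQ A⟩ = ⟨leviHom A, leviHom_mem_levi A⟩ := by
  refine leviToGL_injective (Units.ext ?_)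
  rw [leviToGL_leviQ]
  show blockDiag (mat (leviHom A)) = mat (leviHom A)
  rw [mat_leviHom, blockDiag, toBlocks_fromBlocks₁₁, toBlocks_fromBlocks₂₂]

theorem mat_leviHom_frobGL (p : ℕ) [ExpChar k p] (A : GL (Fin n) k) :
    mat (leviHom (frobGL p k A)) = (mat (leviHom A)).map (frobenius k p) := by
  have h1 : ((frobGL p k A)⁻¹ : GL (Fin n) k) = frobGL p k A⁻¹ := (map_inv _ _).symm
  rw [mat_leviHom, mat_leviHom, h1, fromBlocks_map]
  congr 1
  · ext i j
    simp
  · ext i j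
    simp
  · ext i j
    rw [mul_antiJ_apply, antiJ_mul_apply, transpose_apply, map_apply, mul_antiJ_apply,
      antiJ_mul_apply, transpose_apply]
    rfl

theorem leviHom_mem_zipGroup (p : ℕ) [ExpChar k p] (A : GL (Fin n) k) :
    ((⟨leviHom A, leviHom_mem_parP A⟩, ⟨leviHom (frobGL p k A), leviHom_mem_parQ _⟩) :
      ↥(parP n k) × ↥(parQ n k)) ∈ zipGroup n k p := by
  show frobGL p k (leviToGL n k (leviP n k ⟨leviHom A, leviHom_mem_parP A⟩)) =
    leviToGL n k (leviQ n k ⟨leviHom (frobGL p k A), leviHom_mem_parQ _⟩)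
  rw [leviP_leviHom, leviQ_leviHom]
  exact Units.ext (mat_leviHom_frobGL p A).symm

theorem mem_zipGroup_of_levi_eq_one (p : ℕ) [ExpChar k p] {x : ↥(parP n k)} {y : ↥(parQ n k)}
    (hx : leviP n k x = 1) (hy : leviQ n k y = 1) : (x, y) ∈ zipGroup n k p := by
  show frobGL p k (leviToGL n k (leviP n k x)) = leviToGL n k (leviQ n k y)
  rw [hx, hy, map_one, map_one]

theorem lowerUnipotent_mem_parP (X : Matrix (Fin n) (Fin n) k)
    (hX : Xᵀ * antiJ n k = antiJ n k * X) : lowerUnipotent X hX ∈ parP n k :=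
  mem_parP.2 (by rw [lowerUnipotent, mat_ofMatrix, toBlocks_fromBlocks₁₂])

theorem leviP_lowerUnipotent (X : Matrix (Fin n) (Fin n) k)
    (hX : Xᵀ * antiJ n k = antiJ n k * X) :
    leviP n k ⟨lowerUnipotent X hX, lowerUnipotent_mem_parP X hX⟩ = 1 := by
  refine leviToGL_injective (Units.ext ?_)
  rw [leviToGL_leviP, map_one]
  show blockDiag (mat (lowerUnipotent X hX)) = 1
  rw [lowerUnipotent, mat_ofMatrix, blockDiag, toBlocks_fromBlocks₁₁, toBlocks_fromBlocks₂₂,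
    fromBlocks_one]

/-- An element of the big cell is moved to its Levi component by the unipotent radicals of `P` and
`Q`. -/
theorem exists_unipotent_mul_mul_eq {g : G n k} {A : GL (Fin n) k}
    (hg : corner g = (A : Matrix (Fin n) (Fin n) k)) :
    ∃ (x : ↥(parP n k)) (y : ↥(parQ n k)), leviP n k x = 1 ∧ leviQ n k y = 1 ∧
      (x : G n k) * g * (y : G n k)⁻¹ = leviHom A := by
  obtain ⟨A', B, C, D, hM⟩ := exists_blocks g
  obtain rfl : A' = A := by rw [← hg, corner, hM, toBlocks_fromBlocks₁₁]
  have h := mat_form g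
  rw [hM, fromBlocks_form_iff] at h
  set W : Matrix (Fin n) (Fin n) k := ((A⁻¹ : GL (Fin n) k) : Matrix (Fin n) (Fin n) k) with hW
  have hWA : W * (A : Matrix (Fin n) (Fin n) k) = 1 := Units.inv_mul A
  have hAW : (A : Matrix (Fin n) (Fin n) k) * W = 1 := Units.mul_inv A
  have hWA' : Wᵀ * (A : Matrix (Fin n) (Fin n) k)ᵀ = 1 := by rw [← transpose_mul, hAW, transpose_one]
  have hX : (-(C * W))ᵀ * antiJ n k = antiJ n k * -(C * W) := by
    rw [transpose_neg, transpose_mul, Matrix.neg_mul, Matrix.mul_neg, neg_inj]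
    calc Wᵀ * Cᵀ * antiJ n k = Wᵀ * (Cᵀ * antiJ n k * (A : Matrix (Fin n) (Fin n) k)) * W := by
          simp only [Matrix.mul_assoc, hAW, Matrix.mul_one]
      _ = Wᵀ * (A : Matrix (Fin n) (Fin n) k)ᵀ * (antiJ n k * C * W) := by
          rw [h.1]
          simp only [Matrix.mul_assoc]
      _ = antiJ n k * (C * W) := by rw [hWA', Matrix.one_mul, Matrix.mul_assoc]
  -- Left multiplication by `u` clears the lower left block, so `u g` lies in `Q` with Levi
  -- component that of `A`. The remaining factor of `u g` is unipotent in `Q` and serves as `y`.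
  set u := lowerUnipotent (-(C * W)) hX
  have hu : mat (u * g) = fromBlocks A B 0 (-(C * W) * B + D) := by
    have hmu : mat u = fromBlocks 1 0 (-(C * W)) 1 := rfl
    rw [mat_mul, hM, hmu, fromBlocks_multiply, Matrix.neg_mul (C * W) A.val, Matrix.mul_assoc C,
      hWA]
    simp
  have huQ : u * g ∈ parQ n k := mem_parQ.2 (by rw [hu, toBlocks_fromBlocks₂₁])
  have hlev : leviQ n k ⟨u * g, huQ⟩ = ⟨leviHom A, leviHom_mem_levi A⟩ := by
    obtain ⟨A', h1, h2⟩ := exists_leviHom_eq (leviQ n k ⟨u * g, huQ⟩).2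
    have h3 : A' = A := Units.ext (h2.trans (by
      show (blockDiag (mat (u * g))).toBlocks₁₁ = _
      rw [blockDiag, toBlocks_fromBlocks₁₁, hu, toBlocks_fromBlocks₁₁]))
    exact Subtype.ext (by rw [← h1, h3])
  refine ⟨⟨u, lowerUnipotent_mem_parP _ hX⟩,
    ⟨leviHom A, leviHom_mem_parQ A⟩⁻¹ * ⟨u * g, huQ⟩, leviP_lowerUnipotent _ hX, ?_, ?_⟩
  · rw [map_mul, map_inv, hlev, leviQ_leviHom, inv_mul_cancel]
  · simp only [Subgroup.coe_mul, Subgroup.coe_inv]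
    group

theorem section_apply_one_mem_regularFunctions {p : ℕ} [ExpChar k p] {a : Fin n → ℤ}
    {F : G n k → ↥(indRep k a)} (hF : F ∈ zipSections p k a) :
    (fun g => (F g : ↥(levi n k) → k) 1) ∈ regularFunctions (mat (n := n) (k := k)) := by
  have h := hF.1
  clear hF
  induction h using Submodule.span_induction with
  | mem F h =>
    obtain ⟨f, hf, v, rfl⟩ := h
    have := Subalgebra.smul_mem _ hf ((v : ↥(levi n k) → k) 1)
    convert this using 1
    funext g
    simp [mul_comm]
  | zero => exact Subalgebra.zero_mem _
  | add F F' _ _ h h' => exact Subalgebra.add_mem _ h h'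
  | smul r F _ h => exact Subalgebra.smul_mem _ h r

/-- A nonzero section gives a nonzero semi-invariant polynomial on `M_n`. -/
theorem exists_semiInvariant [IsAlgClosed k] {p : ℕ} [ExpChar k p] {a : Fin n → ℤ}
    (ha : a ∈ zipCone p n k) :
    ∃ Q : MvPolynomial (Fin n × Fin n) k, Q ≠ 0 ∧ ∀ b ∈ lowerBorel n k,
      ∀ x : Matrix (Fin n) (Fin n) k,
        MvPolynomial.eval (fun ij => ((b : Matrix (Fin n) (Fin n) k) * x *
          (((frobGL p k b)⁻¹ : GL (Fin n) k) : Matrix (Fin n) (Fin n) k)) ij.1 ij.2) Q =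
        (∏ i, (b : Matrix (Fin n) (Fin n) k) i i ^ a i) * MvPolynomial.eval (fun ij => x ij.1 ij.2) Q := by
  obtain ⟨F, hF, hF0⟩ := (Submodule.ne_bot_iff _).1 ha
  have heq : ∀ ε ∈ zipGroup n k p, ∀ g : G n k,
      F ((ε.1 : G n k) * g * (ε.2 : G n k)⁻¹) = leviRep k a (leviP n k ε.1) (F g) := hF.2
  set f : G n k → k := fun g => (F g : ↥(levi n k) → k) 1 with hf
  have hlev : ∀ (A : GL (Fin n) k) (g : G n k),
      f (leviHom A * g * leviHom (frobGL p k A)⁻¹) =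
        (F g : ↥(levi n k) → k) (⟨leviHom A, leviHom_mem_levi A⟩⁻¹ * 1) := fun A g => by
    have := heq _ (leviHom_mem_zipGroup p A) g
    rw [leviP_leviHom, ← map_inv] at this
    rw [hf]
    simp only [this]
    rfl
  obtain ⟨Q, hQ⟩ := exists_polynomial_corner (f := f)
    (section_apply_one_mem_regularFunctions hF) (fun g A hg => by
      obtain ⟨x, y, hx, hy, hxy⟩ := exists_unipotent_mul_mul_eq hg
      have := heq _ (mem_zipGroup_of_levi_eq_one p hx hy) g
      rw [hxy, hx, map_one] at this
      rw [hf]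
      simp only [this]
      rfl)
  refine ⟨Q, ?_, fun b hb x => ?_⟩
  -- By `hlev` with `A = x⁻¹`, the value of `F g` at any `x` is a value of `f`; so `Q = 0` would
  -- give `F = 0`.
  · rintro rfl
    refine hF0 (funext fun g => Subtype.ext (funext fun x => ?_))
    obtain ⟨A, hA, -⟩ := exists_leviHom_eq x⁻¹.2
    have h1 := hlev A g
    have h2 : (⟨leviHom A, leviHom_mem_levi A⟩ : ↥(levi n k)) = x⁻¹ := Subtype.ext hA
    rw [hQ, h2, inv_inv, mul_one, map_zero] at h1
    exact h1.symm
  · obtain ⟨g, rfl⟩ := corner_surjective x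
    have h1 := hlev b g
    -- The rule for `B_L` at the product `b⁻¹ b = 1` turns the value of `F g` at `b⁻¹` into `λ(b)`
    -- times its value at 1.
    have h2 := (F g).2.2 (⟨leviHom b, leviHom_mem_levi b⟩⁻¹ * 1) ⟨leviHom b, leviHom_mem_levi b⟩
      (leviHom_mem_borel hb)
    rw [mul_one, inv_mul_cancel, charVal_leviHom] at h2
    have hdiag : ∀ i, (b : Matrix (Fin n) (Fin n) k) i i ≠ 0 := by
      have hdet := ((isUnit_iff_isUnit_det _).1 b.isUnit).ne_zero
      rw [det_of_isLowerTriangular _ fun i j h => hb h] at hdet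
      exact fun i => Finset.prod_ne_zero_iff.1 hdet i (Finset.mem_univ i)
    have h3 : ∏ i, (b : Matrix (Fin n) (Fin n) k) i i ^ a i ≠ 0 :=
      Finset.prod_ne_zero_iff.2 fun i _ => zpow_ne_zero _ (hdiag i)
    rw [← corner_leviHom_mul_mul, ← hQ, ← hQ, h1, hf]
    simp only [h2]
    rw [mul_one, mul_inv_cancel_left₀ h3]

end SemiInvariant


/-! ### Weights of semi-invariant polynomials -/

section Weights

variable {n : ℕ} {k : Type*} [Field k]

theorem prod_zpow_eq_zpow_sum {ι : Type*} (s : Finset ι) {u : k} (hu : u ≠ 0) (e : ι → ℤ) :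
    ∏ i ∈ s, u ^ e i = u ^ ∑ i ∈ s, e i := by
  classical
  induction s using Finset.induction_on with
  | empty => simp
  | insert i s hi ih => rw [Finset.prod_insert hi, Finset.sum_insert hi, zpow_add₀ hu, ih]

theorem eq_zero_of_forall_zpow_eq_one [Infinite k] {z : ℤ} (h : ∀ u : k, u ≠ 0 → u ^ z = 1) :
    z = 0 := by
  have h1 : ∀ u : k, u ≠ 0 → u ^ z.natAbs = 1 := fun u hu => by
    rcases Int.natAbs_eq z with hz | hz
    · rw [← zpow_natCast, ← hz]
      exact h u hu
    · have := h u hu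
      rw [hz, _root_.zpow_neg, inv_eq_one, zpow_natCast] at this
      exact this
  -- The extra factor `X` makes the identity hold at 0 as well.
  have h2 : (Polynomial.X ^ (z.natAbs + 1) : Polynomial k) = Polynomial.X ^ 1 :=
    Polynomial.funext fun u => by
      by_cases hu : u = 0
      · simp [hu]
      · simp [pow_succ, h1 u hu]
  have h3 := congrArg Polynomial.natDegree h2
  rw [Polynomial.natDegree_X_pow, Polynomial.natDegree_X_pow] at h3
  exact Int.natAbs_eq_zero.1 (by omega)

/-- If rescaling the variables multiplies a polynomial by a constant, each of its monomials is
multiplied by that constant. -/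
theorem prod_pow_eq_of_eval_mul [Infinite k] {σ : Type*} [Fintype σ] {Q : MvPolynomial σ k}
    {c : σ → k} {r : k}
    (h : ∀ x : σ → k, MvPolynomial.eval (fun i => c i * x i) Q = r * MvPolynomial.eval x Q)
    {m : σ →₀ ℕ} (hm : m ∈ Q.support) : ∏ i, c i ^ m i = r := by
  have hQ : ∑ d ∈ Q.support, MvPolynomial.monomial d (Q.coeff d * ∏ i, c i ^ d i) =
      MvPolynomial.C r * Q := MvPolynomial.funext fun x => by
    rw [map_mul, MvPolynomial.eval_C, ← h, map_sum, MvPolynomial.eval_eq']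
    refine Finset.sum_congr rfl fun d _ => ?_
    rw [MvPolynomial.eval_monomial, Finsupp.prod_fintype _ _ fun i => pow_zero _]
    simp only [mul_pow, Finset.prod_mul_distrib]
    ring
  classical
  have h1 := congrArg (MvPolynomial.coeff m) hQ
  rw [MvPolynomial.coeff_C_mul, MvPolynomial.coeff_sum] at h1
  simp only [MvPolynomial.coeff_monomial, Finset.sum_ite_eq', if_pos hm] at h1
  exact mul_left_cancel₀ (MvPolynomial.mem_support_iff.1 hm) (h1.trans (mul_comm _ _))

/-- The elements of the diagonal torus of `GL_n`. -/
def torus (t : Fin n → kˣ) : GL (Fin n) k where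
  val := diagonal fun i => (t i : k)
  inv := diagonal fun i => ((t i)⁻¹ : kˣ)
  val_inv := by simp [diagonal_mul_diagonal]
  inv_val := by simp [diagonal_mul_diagonal]

theorem torus_mem_lowerBorel (t : Fin n → kˣ) : torus t ∈ lowerBorel n k := fun _ _ h =>
  diagonal_apply_ne _ (by rintro rfl; exact lt_irrefl _ h)

theorem torus_mul_mul_apply (p : ℕ) [ExpChar k p] (t : Fin n → kˣ) (x : Matrix (Fin n) (Fin n) k)
    (i j : Fin n) :
    ((torus t : Matrix (Fin n) (Fin n) k) * x *
      (((frobGL p k (torus t))⁻¹ : GL (Fin n) k) : Matrix (Fin n) (Fin n) k)) i j =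
      t i * (t j : k)⁻¹ ^ p * x i j := by
  have h1 : (((frobGL p k (torus t))⁻¹ : GL (Fin n) k) : Matrix (Fin n) (Fin n) k) =
      diagonal fun i => (t i : k)⁻¹ ^ p := by
    rw [← map_inv]
    ext i j
    show frobenius k p ((diagonal fun i => (((t i)⁻¹ : kˣ) : k)) i j) = _
    by_cases h : i = j
    · subst h
      simp [frobenius_def]
    · simp [h]
  rw [h1, mul_diagonal]
  show (diagonal (fun i => (t i : k)) * x) i j * _ = _
  rw [diagonal_mul]
  ring

/-- The monomials of a semi-invariant polynomial of weight `a` have weight `a`. -/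
theorem weight_eq_of_semiInvariant [Infinite k] {p : ℕ} [ExpChar k p] {a : Fin n → ℤ}
    {Q : MvPolynomial (Fin n × Fin n) k}
    (hQ : ∀ b ∈ lowerBorel n k, ∀ x : Matrix (Fin n) (Fin n) k,
      MvPolynomial.eval (fun ij => ((b : Matrix (Fin n) (Fin n) k) * x *
        (((frobGL p k b)⁻¹ : GL (Fin n) k) : Matrix (Fin n) (Fin n) k)) ij.1 ij.2) Q =
      (∏ i, (b : Matrix (Fin n) (Fin n) k) i i ^ a i) *
        MvPolynomial.eval (fun ij => x ij.1 ij.2) Q)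
    {m : Fin n × Fin n →₀ ℕ} (hm : m ∈ Q.support) :
    a = ∑ ij, m ij • (Pi.single ij.1 1 - (p : ℤ) • Pi.single ij.2 1 : Fin n → ℤ) := by
  funext l
  rw [← sub_eq_zero]
  refine eq_zero_of_forall_zpow_eq_one (k := k) fun u hu => ?_
  -- The cocharacter of the `l`-th coordinate isolates the `l`-th component of both weights.
  let t : Fin n → kˣ := fun i => if i = l then Units.mk0 u hu else 1
  have ht : ∀ i, (t i : k) = u ^ (Pi.single i 1 : Fin n → ℤ) l := fun i => by
    by_cases h : i = l
    · subst h
      simp [t]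
    · simp [t, h, Ne.symm h]
  have h1 := prod_pow_eq_of_eval_mul (c := fun ij => (t ij.1 : k) * (t ij.2 : k)⁻¹ ^ p)
    (r := ∏ i, (t i : k) ^ a i) (fun x => by
      have := hQ _ (torus_mem_lowerBorel t) (Matrix.of fun i j => x (i, j))
      simp only [torus_mul_mul_apply, Matrix.of_apply] at this
      rw [this]
      congr 1
      exact Finset.prod_congr rfl fun i _ => by
        show (diagonal (fun i => (t i : k)) i i) ^ a i = _
        rw [diagonal_apply_eq]) hm
  have h2 : ∏ i, (t i : k) ^ a i = u ^ a l := by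
    rw [Finset.prod_eq_single l (fun i _ h => by simp [t, h]) (by simp)]
    simp [t]
  have h3 : ∀ ij : Fin n × Fin n, ((t ij.1 : k) * (t ij.2 : k)⁻¹ ^ p) ^ m ij =
      u ^ (m ij • (Pi.single ij.1 1 - (p : ℤ) • Pi.single ij.2 1 : Fin n → ℤ)) l := fun ij => by
    rw [ht, ht, ← _root_.zpow_neg, ← zpow_natCast (_ ^ _) p, ← _root_.zpow_mul, ← zpow_add₀ hu, ← zpow_natCast,
      ← _root_.zpow_mul]
    congr 1
    simp only [Pi.smul_apply, Pi.sub_apply, nsmul_eq_mul, smul_eq_mul]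
    ring
  rw [h2, Finset.prod_congr rfl fun ij _ => h3 ij, prod_zpow_eq_zpow_sum _ hu] at h1
  rw [zpow_sub₀ hu, ← h1, Finset.sum_apply, div_self (zpow_ne_zero _ hu)]

/-- A nonzero `Q` cannot vanish on a nonempty open set, and semi-invariance carries its nonvanishing
along `B_L`-orbits into `M_Σ`. A monomial that is nonzero at a point of `M_Σ` involves only
variables indexed by `Σ`, and its weight is `λ`. -/
theorem zipCone_subset_monomialCone [IsAlgClosed k] {p : ℕ} [ExpChar k p]
    {S : Set (Fin n × Fin n)} (hS : IsLarge p k S) : zipCone p n k ⊆ monomialCone p S := by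
  intro a ha
  obtain ⟨Q, hQ0, hQ⟩ := exists_semiInvariant ha
  obtain ⟨U, ⟨I, rfl⟩, ⟨x₀, hx₀⟩, hU⟩ := hS
  simp only [Set.mem_ofPred_eq, MvPolynomial.mem_zeroLocus_iff, not_forall] at hx₀
  obtain ⟨D, hDI, hD⟩ := hx₀
  rw [MvPolynomial.aeval_eq_eval] at hD
  have hD0 : D ≠ 0 := by rintro rfl; exact hD (map_zero _)
  obtain ⟨x, hx⟩ : ∃ x, MvPolynomial.eval x (Q * D) ≠ 0 := by
    by_contra! h
    exact mul_ne_zero hQ0 hD0 (MvPolynomial.funext fun x => by rw [h, map_zero])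
  rw [map_mul] at hx
  obtain ⟨b, hb, hy⟩ := hU (Matrix.of fun i j => x (i, j)) (fun h => by
    have := (MvPolynomial.mem_zeroLocus_iff.1 h) D hDI
    rw [MvPolynomial.aeval_eq_eval] at this
    exact right_ne_zero_of_mul hx this)
  have hdiag : (∏ i, (b : Matrix (Fin n) (Fin n) k) i i ^ a i) ≠ 0 := by
    have hdet := ((isUnit_iff_isUnit_det _).1 b.isUnit).ne_zero
    rw [det_of_isLowerTriangular _ fun i j h => hb h] at hdet
    exact Finset.prod_ne_zero_iff.2 fun i hi => zpow_ne_zero _ (Finset.prod_ne_zero_iff.1 hdet i hi)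
  have h1 := hQ b hb (Matrix.of fun i j => x (i, j))
  set y := (b : Matrix (Fin n) (Fin n) k) * (Matrix.of fun i j => x (i, j)) *
    (((frobGL p k b)⁻¹ : GL (Fin n) k) : Matrix (Fin n) (Fin n) k)
  have h2 : MvPolynomial.eval (fun ij : Fin n × Fin n => y ij.1 ij.2) Q ≠ 0 := by
    rw [h1]
    exact mul_ne_zero hdiag (left_ne_zero_of_mul hx)
  rw [MvPolynomial.eval_eq'] at h2
  obtain ⟨m, hm, hmy⟩ := Finset.exists_ne_zero_of_sum_ne_zero h2
  rw [weight_eq_of_semiInvariant hQ hm]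
  refine AddSubmonoid.sum_mem _ fun ij _ => ?_
  by_cases h : ij ∈ S
  · exact AddSubmonoid.nsmul_mem _ (mem_monomialCone p h) _
  · have h3 : m ij = 0 := by
      by_contra h4
      refine hmy (mul_eq_zero_of_right _ (Finset.prod_eq_zero (Finset.mem_univ ij) ?_))
      rw [hy ij.1 ij.2 h, zero_pow h4]
    rw [h3, zero_smul]
    exact AddSubmonoid.zero_mem _

end Weights


/-! ### Dominance of the weights of sections -/

section Dominance

variable {n : ℕ} {k : Type*} [Field k]

/-- The elementary matrices, as elements of `GL_n`. -/
def elementary {i j : Fin n} (h : i ≠ j) (t : k) : GL (Fin n) k where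
  val := transvection i j t
  inv := transvection i j (-t)
  val_inv := by rw [transvection_mul_transvection_same _ _ h, add_neg_cancel, transvection_zero]
  inv_val := by rw [transvection_mul_transvection_same _ _ h, neg_add_cancel, transvection_zero]

/-- The lower triangular matrix occurring in the factorization of an upper elementary matrix
through the opposite big cell. -/
def elementaryLower {i j : Fin n} (h : i ≠ j) (t : k) : GL (Fin n) k :=
  (elementary h (1 - t⁻¹))⁻¹ * (elementary h.symm (-1))⁻¹ * (elementary h 1)⁻¹ * elementary h t

theorem coe_elementaryLower {i j : Fin n} (h : i ≠ j) {t : k} (ht : t ≠ 0) :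
    (elementaryLower h t : Matrix (Fin n) (Fin n) k) =
      1 + single i i (t⁻¹ - 1) + single j j (t - 1) + single j i 1 := by
  show transvection i j (-(1 - t⁻¹)) * transvection j i (-(-1)) * transvection i j (-1) *
    transvection i j t = _
  rw [Matrix.mul_assoc _ (transvection i j (-1)), transvection_mul_transvection_same _ _ h]
  simp only [transvection, Matrix.mul_add, Matrix.add_mul, Matrix.mul_one, Matrix.one_mul,
    single_mul_single_same, single_mul_single_of_ne _ _ _ _ h.symm]
  -- Writing every `single` as a multiple of a fixed matrix leaves an identity that can be checked
  -- coefficient by coefficient.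
  obtain ⟨S, hS⟩ : ∃ S : Fin n → Fin n → Matrix (Fin n) (Fin n) k,
      ∀ a b c, single a b c = c • S a b :=
    ⟨fun a b => single a b 1, fun a b c => by rw [smul_single, smul_eq_mul, mul_one]⟩
  simp only [hS]
  match_scalars <;> field_simp <;> ring

theorem elementaryLower_mem {i j : Fin n} (h : i < j) {t : k} (ht : t ≠ 0) :
    elementaryLower h.ne t ∈ lowerBorel n k := fun a b hab => by
  have hab : a < b := hab
  rw [coe_elementaryLower h.ne ht]
  simp only [Matrix.add_apply, single_apply, one_apply]
  rw [if_neg hab.ne, if_neg (by omega), if_neg (by omega), if_neg (by omega)]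
  simp

theorem charVal_elementaryLower {i j : Fin n} (h : i ≠ j) {t : k} (ht : t ≠ 0) (a : Fin n → ℤ) :
    charVal a (leviHom (elementaryLower h t)) = t ^ (a j - a i) := by
  rw [charVal_leviHom, coe_elementaryLower h ht]
  have h1 : ∀ l, (1 + single i i (t⁻¹ - 1) + single j j (t - 1) + single j i 1 :
      Matrix (Fin n) (Fin n) k) l l = (if l = i then t⁻¹ else 1) * (if l = j then t else 1) := by
    intro l
    simp only [Matrix.add_apply, single_apply, one_apply]
    by_cases hi : l = i
    · subst hi
      simp [h, h.symm]
    · by_cases hj : l = j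
      · subst hj
        simp [h, h.symm]
      · simp [hi, hj, Ne.symm hi, Ne.symm hj]
  simp only [h1, mul_zpow, Finset.prod_mul_distrib]
  rw [Finset.prod_eq_single i (fun l _ hl => by simp [hl]) (by simp),
    Finset.prod_eq_single j (fun l _ hl => by simp [hl]) (by simp), if_pos rfl, if_pos rfl,
    zpow_sub₀ ht, _root_.inv_zpow, div_eq_mul_inv, mul_comm]

/-- The isomorphism of `GL_n` with the Levi subgroup. -/
def toLevi : GL (Fin n) k →* ↥(levi n k) := leviHom.codRestrict (levi n k) leviHom_mem_levi

theorem leviMat_mul_elementary (x : ↥(levi n k)) {i j : Fin n} (h : i ≠ j) (t : k) :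
    leviMat (x * toLevi (elementary h t)) = leviMat x + t • (leviMat x *
      fromBlocks (single i j 1) 0 0 (antiJ n k * (-single i j 1)ᵀ * antiJ n k)) := by
  have h1 : mat (leviHom (elementary h t)) = 1 + t •
      fromBlocks (single i j 1) 0 0 (antiJ n k * (-single i j 1)ᵀ * antiJ n k) := by
    show fromBlocks (transvection i j t) 0 0
      (antiJ n k * (transvection i j (-t))ᵀ * antiJ n k) = _
    rw [← fromBlocks_one, fromBlocks_smul, fromBlocks_add]
    have h2 : ∀ s : k, transvection i j s = 1 + s • single i j 1 := fun s => by
      rw [transvection, smul_single, smul_eq_mul, mul_one]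
    simp only [h2, smul_zero, add_zero, transpose_add, transpose_one, transpose_smul,
      transpose_neg, Matrix.mul_add, Matrix.add_mul, Matrix.mul_one, antiJ_mul_antiJ,
      Matrix.mul_smul, Matrix.smul_mul, Matrix.mul_neg, Matrix.neg_mul, neg_smul, smul_neg]
  show mat (x : G n k) * mat (leviHom (elementary h t)) = _
  rw [h1, Matrix.mul_add, Matrix.mul_one, Matrix.mul_smul]
  rfl

/-- A polynomial `q` with `t ^ e q(t) = r(1 / t)` for a polynomial `r` and `e ≥ 1` vanishes. -/
theorem eq_zero_of_pow_mul_eval_eq [Infinite k] {q r : Polynomial k} {e : ℕ} (he : 1 ≤ e)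
    (h : ∀ t : k, t ≠ 0 → t ^ e * q.eval t = r.eval t⁻¹) : q = 0 := by
  by_contra hq
  -- Multiplying by `t ^ deg r` turns `r(1 / t)` into the reversed polynomial, of degree at most
  -- `deg r`, whereas the other side has degree at least `e + deg r`. The common factor `X` covers
  -- `t = 0`.
  have h1 : Polynomial.X * (Polynomial.X ^ (e + r.natDegree) * q) =
      Polynomial.X * r.reverse := Polynomial.funext fun t => by
    by_cases ht : t = 0
    · simp [ht]
    · let _ : Invertible t⁻¹ := invertibleOfNonzero (inv_ne_zero ht)
      have h2 := Polynomial.eval₂_reverse_mul_pow (RingHom.id k) t⁻¹ r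
      rw [← Polynomial.eval, ← Polynomial.eval, invOf_eq_inv, inv_inv, ← h t ht] at h2
      simp only [Polynomial.eval_mul, Polynomial.eval_X, Polynomial.eval_pow]
      congr 1
      rw [pow_add, mul_assoc, mul_left_comm, ← h2, mul_left_comm, inv_pow,
        mul_inv_cancel₀ (pow_ne_zero _ ht), mul_one]
  have h3 := congrArg Polynomial.natDegree (mul_left_cancel₀ Polynomial.X_ne_zero h1)
  rw [Polynomial.natDegree_mul (pow_ne_zero _ Polynomial.X_ne_zero) hq,
    Polynomial.natDegree_X_pow] at h3
  have := Polynomial.reverse_natDegree_le r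
  omega

/-- Let `u(t)` be the upper elementary matrix at `(i, j)` and `v` the lower one at `(j, i)` with
parameter `-1`. For `t ≠ 0`, `u(t) = u(1) v u(1 - t⁻¹) b(t)` with `b(t)` lower triangular and
`λ(b(t)) = t ^ (a_j - a_i)`. Hence `t ^ (a_j - a_i) f(x u(t))` is a polynomial in `t⁻¹`, while `f(x
u(t))` is one in `t`. If `a_j > a_i`, this forces `f(x u(t)) = 0`, and `t = 0` gives `f(x) = 0`. -/
theorem le_of_mem_indRep [Infinite k] {a : Fin n → ℤ} {f : ↥(levi n k) → k} (hf : f ∈ indRep k a)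
    (hf0 : f ≠ 0) {i j : Fin n} (hij : i < j) : a j ≤ a i := by
  by_contra! hlt
  obtain ⟨x, hx⟩ := Function.ne_iff.1 hf0
  have hpol : ∀ x : ↥(levi n k), ∃ q : Polynomial k,
      ∀ t, f (x * toLevi (elementary hij.ne t)) = q.eval t := fun x =>
    exists_polynomial_of_affine hf.1 (fun t => x * toLevi (elementary hij.ne t)) _ _
      (leviMat_mul_elementary x hij.ne)
  obtain ⟨q, hq⟩ := hpol x
  obtain ⟨r, hr⟩ := hpol (x * toLevi (elementary hij.ne 1) * toLevi (elementary hij.ne.symm (-1)))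
  have hq0 : q = 0 := eq_zero_of_pow_mul_eval_eq (r := r.comp (1 - Polynomial.X))
      (e := (a j - a i).toNat) (by omega) fun t ht => by
    have h1 : x * toLevi (elementary hij.ne t) = x * toLevi (elementary hij.ne 1) *
        toLevi (elementary hij.ne.symm (-1)) * toLevi (elementary hij.ne (1 - t⁻¹)) *
          toLevi (elementaryLower hij.ne t) := by
      simp only [elementaryLower, map_mul, map_inv]
      group
    have h2 := hf.2 (x * toLevi (elementary hij.ne 1) *
      toLevi (elementary hij.ne.symm (-1)) * toLevi (elementary hij.ne (1 - t⁻¹)))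
      (toLevi (elementaryLower hij.ne t)) (leviHom_mem_borel (elementaryLower_mem hij ht))
    have h3 : charVal a ((toLevi (elementaryLower hij.ne t) : ↥(levi n k)) : G n k) =
      t ^ (a j - a i).toNat := by
      rw [← zpow_natCast, Int.toNat_of_nonneg (by omega)]
      exact charVal_elementaryLower hij.ne ht a
    rw [← h1, h3, hq, hr] at h2
    rw [h2, mul_inv_cancel_left₀ (pow_ne_zero _ ht)]
    simp
  refine hx ?_
  have h1 : toLevi (elementary hij.ne (0 : k)) = 1 := by
    have : elementary hij.ne (0 : k) = 1 := Units.ext (transvection_zero i j)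
    rw [this, map_one]
  have h2 := hq 0
  rw [h1, mul_one, hq0, Polynomial.eval_zero] at h2
  exact h2

theorem zipCone_subset_dominantCone [Infinite k] {p : ℕ} [ExpChar k p] :
    zipCone p n k ⊆ dominantCone n := by
  intro a ha i j hij
  obtain ⟨F, -, hF0⟩ := (Submodule.ne_bot_iff _).1 ha
  obtain ⟨g, hg⟩ := Function.ne_iff.1 hF0
  have := le_of_mem_indRep (F g).2 (fun h => hg (Subtype.ext h)) (show i < j by
    rw [Fin.lt_def]
    omega)
  simpa [dotProduct_sub] using this

end Dominance

end

end SympZip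

theorem mainTheorem8 (p : ℕ) [Fact p.Prime] (k : Type*) [Field k] [CharP k p]
    [Algebra (ZMod p) k] [IsAlgClosure (ZMod p) k] (n : ℕ) (hn : 1 ≤ n) :
    (SympZip.saturation (SympZip.zipCone p n k) ⊆
        SympZip.polCone p n ∩ SympZip.dominantCone n) ∧
      (∀ S : Set (Fin n × Fin n), SympZip.IsLarge p k S →
        SympZip.saturation (SympZip.zipCone p n k) ⊆ SympZip.monomialCone p S) ∧
      SympZip.IsLarge p k (SympZip.sigmaOne n) ∧
      SympZip.saturation (SympZip.zipCone p n k) ⊆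
        SympZip.monomialCone p (SympZip.sigmaOne' n) ∩ SympZip.dominantCone n := by
  have : IsAlgClosed k := IsAlgClosure.isAlgClosed (ZMod p)
  have hdom : SympZip.saturation (SympZip.zipCone p n k) ⊆ SympZip.dominantCone n :=
    (SympZip.saturation_mono SympZip.zipCone_subset_dominantCone).trans
      SympZip.saturation_dominantCone_subset
  have hmon : ∀ S : Set (Fin n × Fin n), SympZip.IsLarge p k S →
      SympZip.saturation (SympZip.zipCone p n k) ⊆ SympZip.monomialCone p S := fun S hS =>
    SympZip.saturation_subset_sGenerated (SympZip.zipCone_subset_monomialCone hS)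
  have hlarge : SympZip.IsLarge p k (SympZip.sigmaOne n) := SympZip.isLarge_sigmaOne p n
  refine ⟨Set.subset_inter ?_ hdom, hmon, hlarge, Set.subset_inter ?_ hdom⟩
  · exact (hmon _ hlarge).trans (SympZip.monomialCone_subset_polCone p _)
  · exact (hmon _ hlarge).trans (SympZip.monomialCone_sigmaOne_subset p)
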